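/- Let $D=I\times J\subset\mathbb R^2$ be an open coordinate rectangle ($I,J$ non-empty open intervals, possibly unbounded), and let $$S=A\,\frac{\partial}{\partial x}\otimes dx+B\,\frac{\partial}{\partial y}\otimes dy$$ with $A,B:D\to\mathbb R$ smooth and $A>B$ on $D$. A normally oriented immersion $(\mathbf x,\mathbf n)$, consisting of a smooth immersion $\mathbf x:D\to\mathbb E^3$ and a smooth unit normal $\mathbf n:D\to S^2$, realizes $S$ if its fundamental forms $\mathrm I=d\mathbf x\cdot d\mathbf x$ and $\mathrm{II}=-d\mathbf n\cdot d\mathbf x$ satisfy $\mathrm{II}(v,w)=\mathrm I(v,Sw)=\mathrm I(Sv,w)$ for all tangent vectors $v,w$. Two such pairs are congruent if an isometry of $\mathbb E^3$ (possibly orientation-reversing) carries one immersion to the other and its linear part carries one unit normal to the other. Consider the inhomogeneous linear system for smooth functions $a,b$ on $D$ $$a_y=\frac{2A_y}{A-B}\,a,\qquad b_x=\frac{2B_x}{B-A}\,b,$$ $$\begin{aligned}-2AB(A-B)^2={}&(A-B)B_x\,a_x-2\bigl(B_xA_x-2B_x^2+(B-A)B_{xx}\bigr)a\\&+(B-A)A_y\,b_y-2\bigl(A_yB_y-2A_y^2+(A-B)A_{yy}\bigr)b.\end{aligned}$$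 Then the set of solutions $(a,b)$ of this system is a (possibly empty) affine subspace of the space of pairs of real functions on $D$. Moreover, the assignment $$(\mathbf x,\mathbf n)\longmapsto(a,b)=\left(\frac1{\mathrm I(\partial_x,\partial_x)},\ \frac1{\mathrm I(\partial_y,\partial_y)}\right)$$ induces a well-defined injective map from the set of congruence classes of normally oriented immersions realizing $S$ into this affine space; its image is exactly the set of solutions with $a>0$ and $b>0$ on $D$, and this image is convex. -/

import Mathlib

open scoped ContDiff

namespace PrescribedShape

noncomputable section

/-- Euclidean `3`-space. -/
abbrev E3 : Type := EuclideanSpace ℝ (Fin 3)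

/-- The partial derivative with respect to the first coordinate `x`. -/
def dx {F : Type*} [NormedAddCommGroup F] [NormedSpace ℝ F] (f : ℝ × ℝ → F) : ℝ × ℝ → F :=
  fun p => fderiv ℝ f p (1, 0)

/-- The partial derivative with respect to the second coordinate `y`. -/
def dy {F : Type*} [NormedAddCommGroup F] [NormedSpace ℝ F] (f : ℝ × ℝ → F) : ℝ × ℝ → F :=
  fun p => fderiv ℝ f p (0, 1)

/-- The field of endomorphisms `S = A ∂/∂x ⊗ dx + B ∂/∂y ⊗ dy` of the tangent bundle. -/
def shapeOp (A B : ℝ × ℝ → ℝ) (p : ℝ × ℝ) : ℝ × ℝ →L[ℝ] ℝ × ℝ :=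
  (A p • ContinuousLinearMap.fst ℝ ℝ ℝ).prod (B p • ContinuousLinearMap.snd ℝ ℝ ℝ)

/-- The first fundamental form `I = dX · dX` of `X`, at `p`. -/
def firstForm (X : ℝ × ℝ → E3) (p v w : ℝ × ℝ) : ℝ :=
  inner ℝ (fderiv ℝ X p v) (fderiv ℝ X p w)

/-- The second fundamental form `II = - dN · dX` of `(X, N)`, at `p`. -/
def secondForm (X N : ℝ × ℝ → E3) (p v w : ℝ × ℝ) : ℝ :=
  - inner ℝ (fderiv ℝ N p v) (fderiv ℝ X p w)

/-- A smooth normally oriented immersion `(X, N)` of the open set `D` into Euclidean `3`-space,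
whose shape operator is `S`.  Only the values of `X` and `N` on `D` matter. -/
structure Realization (D : Set (ℝ × ℝ)) (S : ℝ × ℝ → (ℝ × ℝ →L[ℝ] ℝ × ℝ)) where
  /-- the immersion -/
  X : ℝ × ℝ → E3
  /-- the choice of unit normal -/
  N : ℝ × ℝ → E3
  smooth_X : ContDiffOn ℝ ∞ X D
  smooth_N : ContDiffOn ℝ ∞ N D
  immersion : ∀ p ∈ D, Function.Injective (fderiv ℝ X p)
  unit : ∀ p ∈ D, inner ℝ (N p) (N p) = (1 : ℝ)
  normal : ∀ p ∈ D, ∀ v, inner ℝ (N p) (fderiv ℝ X p v) = (0 : ℝ)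
  shape : ∀ p ∈ D, ∀ v w, secondForm X N p v w = firstForm X p v (S p w) ∧
    secondForm X N p v w = firstForm X p (S p v) w

/-- Euclidean congruence: some isometry of Euclidean `3`-space (possibly reversing the orientation)
carries one immersion to the other and its linear part carries one unit normal to the other. -/
def Congruent {D : Set (ℝ × ℝ)} {S : ℝ × ℝ → (ℝ × ℝ →L[ℝ] ℝ × ℝ)} (r s : Realization D S) : Prop :=
  ∃ g : E3 ≃ᵃⁱ[ℝ] E3, ∀ p ∈ D, s.X p = g (r.X p) ∧ s.N p = g.linearIsometryEquiv (r.N p)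

/-- Congruence as an equivalence relation. -/
def congruenceSetoid (D : Set (ℝ × ℝ)) (S : ℝ × ℝ → (ℝ × ℝ →L[ℝ] ℝ × ℝ)) :
    Setoid (Realization D S) where
  r := Congruent
  iseqv :=
    { refl := fun _ => ⟨AffineIsometryEquiv.refl ℝ E3, fun _ _ => ⟨rfl, rfl⟩⟩
      symm := by
        rintro r s ⟨g, hg⟩
        refine ⟨g.symm, fun p hp => ⟨?_, ?_⟩⟩
        · rw [(hg p hp).1, g.symm_apply_apply]
        · rw [(hg p hp).2]
          exact (g.linearIsometryEquiv.symm_apply_apply _).symm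
      trans := by
        rintro r s t ⟨g, hg⟩ ⟨h, hh⟩
        refine ⟨g.trans h, fun p hp => ⟨?_, ?_⟩⟩
        · rw [(hh p hp).1, (hg p hp).1]; rfl
        · rw [(hh p hp).2, (hg p hp).2]; rfl }

/-- The space of Euclidean congruence classes of normally oriented immersions of `D` that
realize `S`. -/
def CongruenceClass (D : Set (ℝ × ℝ)) (S : ℝ × ℝ → (ℝ × ℝ →L[ℝ] ℝ × ℝ)) : Type :=
  Quotient (congruenceSetoid D S)

/-- The class of a realization. -/
def Realization.toClass {D : Set (ℝ × ℝ)} {S : ℝ × ℝ → (ℝ × ℝ →L[ℝ] ℝ × ℝ)}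
    (r : Realization D S) : CongruenceClass D S :=
  Quotient.mk (congruenceSetoid D S) r

/-- The pair of functions `(a, b)` on `D` for which `dx / √a` and `dy / √b` are the unit coframe of
the realization: `a = 1 / I(∂/∂x, ∂/∂x)` and `b = 1 / I(∂/∂y, ∂/∂y)`. -/
def Realization.coeffs {D : Set (ℝ × ℝ)} {S : ℝ × ℝ → (ℝ × ℝ →L[ℝ] ℝ × ℝ)}
    (r : Realization D S) : (D → ℝ) × (D → ℝ) :=
  (fun p => 1 / firstForm r.X p (1, 0) (1, 0), fun p => 1 / firstForm r.X p (0, 1) (0, 1))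

/-- The smooth functions `a`, `b` satisfy on `D` the inhomogeneous linear system of partial
differential equations determined by `A` and `B`. -/
structure SolvesSystem (A B : ℝ × ℝ → ℝ) (D : Set (ℝ × ℝ)) (a b : ℝ × ℝ → ℝ) : Prop where
  smooth_a : ContDiffOn ℝ ∞ a D
  smooth_b : ContDiffOn ℝ ∞ b D
  eq_a : ∀ p ∈ D, dy a p = 2 * dy A p / (A p - B p) * a p
  eq_b : ∀ p ∈ D, dx b p = 2 * dx B p / (B p - A p) * b p
  eq_ab : ∀ p ∈ D,
    -2 * A p * B p * (A p - B p) ^ 2 =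
      (A p - B p) * dx B p * dx a p
        - 2 * (dx B p * dx A p - 2 * dx B p ^ 2 + (B p - A p) * dx (dx B) p) * a p
        + (B p - A p) * dy A p * dy b p
        - 2 * (dy A p * dy B p - 2 * dy A p ^ 2 + (A p - B p) * dy (dy A) p) * b p

/-- The set of all smooth solutions of the system, as pairs of functions on `D`. -/
def solutionSet (A B : ℝ × ℝ → ℝ) (D : Set (ℝ × ℝ)) : Set ((D → ℝ) × (D → ℝ)) :=
  {s | ∃ a b : ℝ × ℝ → ℝ, SolvesSystem A B D a b ∧ s = (D.domRestrict a, D.domRestrict b)}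

end

end PrescribedShape

/-! ### Integrals with a parameter on a rectangle. -/

namespace PrescribedShape

open scoped Interval
open Set Filter Topology MeasureTheory intervalIntegral

/-! Write `E`, `G` for the squared lengths of `X_x`, `X_y`, and `p = B_x / (A - B)`, `q = -A_y / (A
- B)`. As `S` is self-adjoint with distinct eigenvalues, the coordinates are orthogonal, and `N_x =
-A X_x`, `N_y = -B X_y`. Equality of the mixed derivatives of `N` gives `X_xy = q X_x + p X_y`,
hence the Codazzi equations `E_y = 2qE`, `G_x = 2pG`. With `a = 1/E`, `b = 1/G` these become the
first two equations of the system, and the Gauss equation divided by `EG` becomes linear in `a`,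
`b`: it is the third equation (`solvesSystem_iff`, `Realization.solvesSystem`).

The map is injective because `E`, `G`, `A`, `B` determine all inner products of the frame `(X_x,
X_y, N)` with its derivatives, so two realizations with equal `E`, `G` have frames that differ by a
constant linear isometry (`exists_isometry_of_gram_eq`, `Realization.congruent_of_normSq_eq`).

For surjectivity onto positive solutions, the Gauss-Weingarten equations with the coefficients
dictated by `a`, `b` form a linear total differential system. It is flat exactly by the Codazzi and
Gauss equations, so it is solvable on the rectangle (`exists_smooth_solution_of_flat`); a conserved
quadratic form shows that the solution frame keeps the prescribed lengths and angles
(`SolvesSystem.exists_realization`).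

The system is linear inhomogeneous, so its solutions form an affine space, and positivity cuts out a
convex subset. -/

theorem exists_Icc_nhds {I : Set ℝ} (hI : IsOpen I) (hc : I.OrdConnected) {x₀ x : ℝ}
    (hx₀ : x₀ ∈ I) (hx : x ∈ I) :
    ∃ α β, α < x ∧ x < β ∧ x₀ ∈ Icc α β ∧ α ≤ β ∧ Icc α β ⊆ I := by
  have hmin : min x₀ x ∈ I := by rcases min_choice x₀ x with h | h <;> rwa [h]
  have hmax : max x₀ x ∈ I := by rcases max_choice x₀ x with h | h <;> rwa [h]
  obtain ⟨α, hα, hαI⟩ := exists_Ioc_subset_of_mem_nhds (hI.mem_nhds hmin) ⟨_, sub_one_lt _⟩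
  obtain ⟨β, hβ, hβI⟩ := exists_Ico_subset_of_mem_nhds (hI.mem_nhds hmax) ⟨_, lt_add_one _⟩
  obtain ⟨α', h1, h2⟩ := exists_between hα
  obtain ⟨β', h3, h4⟩ := exists_between hβ
  have h5 := min_le_left x₀ x
  have h6 := min_le_right x₀ x
  have h7 := le_max_left x₀ x
  have h8 := le_max_right x₀ x
  exact ⟨α', β', by linarith, by linarith, ⟨by linarith, by linarith⟩, by linarith,
    hc.out (hαI ⟨h1, h2.le⟩) (hβI ⟨h3.le, h4⟩)⟩

/-- Clamping both coordinates to the rectangle gives a globally continuous function, as the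
continuity theorem for parametric integrals requires. -/
theorem exists_continuous_eqOn_Icc_prod {W : Type*} [TopologicalSpace W] {D : Set (ℝ × ℝ)}
    {f : ℝ × ℝ → W} (hf : ContinuousOn f D) {α β c d : ℝ} (hαβ : α ≤ β) (hcd : c ≤ d)
    (hD : Icc α β ×ˢ Icc c d ⊆ D) :
    ∃ g : ℝ × ℝ → W, Continuous g ∧ EqOn g f (Icc α β ×ˢ Icc c d) := by
  refine ⟨fun p => f (projIcc α β hαβ p.1, projIcc c d hcd p.2), ?_, ?_⟩
  · refine hf.comp_continuous (by fun_prop) fun p => hD ⟨?_, ?_⟩ <;> exact Subtype.coe_prop _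
  · rintro ⟨x, y⟩ ⟨hx, hy⟩
    simp only at hx hy
    simp [projIcc_of_mem _ hx, projIcc_of_mem _ hy]

theorem intervalIntegrable_fst {W : Type*} [NormedAddCommGroup W] {I J : Set ℝ}
    (hIc : I.OrdConnected) {f : ℝ × ℝ → W}
    (hf : ContinuousOn f (I ×ˢ J)) {x₀ x y : ℝ} (hx₀ : x₀ ∈ I) (hx : x ∈ I) (hy : y ∈ J) :
    IntervalIntegrable (fun t => f (t, y)) volume x₀ x :=
  (hf.comp (by fun_prop) fun _ ht => ⟨hIc.uIcc_subset hx₀ hx ht, hy⟩).intervalIntegrable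

theorem intervalIntegrable_snd {W : Type*} [NormedAddCommGroup W] {I J : Set ℝ}
    (hJc : J.OrdConnected) {f : ℝ × ℝ → W}
    (hf : ContinuousOn f (I ×ˢ J)) {x y₀ y : ℝ} (hx : x ∈ I) (hy₀ : y₀ ∈ J) (hy : y ∈ J) :
    IntervalIntegrable (fun s => f (x, s)) volume y₀ y :=
  (hf.comp (by fun_prop) fun _ ht => ⟨hx, hJc.uIcc_subset hy₀ hy ht⟩).intervalIntegrable

section Integrals

variable {W : Type*} [NormedAddCommGroup W] [NormedSpace ℝ W] {I J : Set ℝ}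

theorem continuousOn_integral_fst (hI : IsOpen I) (hIc : I.OrdConnected) (hJ : IsOpen J)
    (hJc : J.OrdConnected) {x₀ : ℝ} (hx₀ : x₀ ∈ I) {f : ℝ × ℝ → W}
    (hf : ContinuousOn f (I ×ˢ J)) :
    ContinuousOn (fun p : ℝ × ℝ => ∫ t in x₀..p.1, f (t, p.2)) (I ×ˢ J) := by
  rintro ⟨x, y⟩ ⟨hx, hy⟩
  simp only at hx hy
  obtain ⟨α, β, hα, hβ, h0, hαβ, hsub⟩ := exists_Icc_nhds hI hIc hx₀ hx
  obtain ⟨c, d, hc, hd, -, hcd, hsub'⟩ := exists_Icc_nhds hJ hJc hy hy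
  obtain ⟨g, hg, hgf⟩ := exists_continuous_eqOn_Icc_prod hf hαβ hcd (prod_mono hsub hsub')
  have hg' : Continuous fun p : ℝ × ℝ => ∫ t in x₀..p.1, g (t, p.2) :=
    continuous_parametric_intervalIntegral_of_continuous (f := fun (p : ℝ × ℝ) t => g (t, p.2))
      (by simp only [Function.uncurry_def]; fun_prop) continuous_fst
  refine (hg'.continuousAt.congr ?_).continuousWithinAt
  have : Icc α β ×ˢ Icc c d ∈ 𝓝 (x, y) :=
    prod_mem_nhds (Icc_mem_nhds hα hβ) (Icc_mem_nhds hc hd)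
  filter_upwards [this] with p hp
  refine integral_congr fun t ht => hgf ⟨?_, hp.2⟩
  exact uIcc_subset_Icc h0 hp.1 ht

theorem continuousOn_integral_snd (hI : IsOpen I) (hIc : I.OrdConnected) (hJ : IsOpen J)
    (hJc : J.OrdConnected) {y₀ : ℝ} (hy₀ : y₀ ∈ J) {f : ℝ × ℝ → W}
    (hf : ContinuousOn f (I ×ˢ J)) :
    ContinuousOn (fun p : ℝ × ℝ => ∫ s in y₀..p.2, f (p.1, s)) (I ×ˢ J) :=
  (continuousOn_integral_fst hJ hJc hI hIc hy₀ (f := fun p => f (p.2, p.1))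
    (hf.comp continuous_swap.continuousOn fun _ hp => ⟨hp.2, hp.1⟩)).comp
    continuous_swap.continuousOn fun _ hp => ⟨hp.2, hp.1⟩

theorem hasDerivAt_integral_fst [CompleteSpace W] (hI : IsOpen I) (hIc : I.OrdConnected)
    {f : ℝ × ℝ → W} (hf : ContinuousOn f (I ×ˢ J)) {x₀ x y : ℝ} (hx₀ : x₀ ∈ I) (hx : x ∈ I)
    (hy : y ∈ J) :
    HasDerivAt (fun x => ∫ t in x₀..x, f (t, y)) (f (x, y)) x := by
  have hfy : ContinuousOn (fun t => f (t, y)) I := hf.comp (by fun_prop) fun t ht => ⟨ht, hy⟩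
  exact integral_hasDerivAt_right (intervalIntegrable_fst hIc hf hx₀ hx hy)
    (hfy.stronglyMeasurableAtFilter hI x hx) (hfy.continuousAt (hI.mem_nhds hx))

theorem hasDerivAt_integral_snd [CompleteSpace W] (hJ : IsOpen J) (hJc : J.OrdConnected)
    {f : ℝ × ℝ → W} (hf : ContinuousOn f (I ×ˢ J)) {x y₀ y : ℝ} (hx : x ∈ I) (hy₀ : y₀ ∈ J)
    (hy : y ∈ J) :
    HasDerivAt (fun y => ∫ s in y₀..y, f (x, s)) (f (x, y)) y :=
  hasDerivAt_integral_fst hJ hJc (f := fun p => f (p.2, p.1))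
    (hf.comp continuous_swap.continuousOn fun _ hp => ⟨hp.2, hp.1⟩) hy₀ hy hx

theorem hasDerivAt_integral_param (hI : IsOpen I) (hIc : I.OrdConnected)
    (hJc : J.OrdConnected) {f f' : ℝ × ℝ → W} (hf : ContinuousOn f (I ×ˢ J))
    (hf' : ContinuousOn f' (I ×ˢ J))
    (hd : ∀ x ∈ I, ∀ y ∈ J, HasDerivAt (fun t => f (t, y)) (f' (x, y)) x) {x y₀ y : ℝ}
    (hx : x ∈ I) (hy₀ : y₀ ∈ J) (hy : y ∈ J) :
    HasDerivAt (fun x => ∫ s in y₀..y, f (x, s)) (∫ s in y₀..y, f' (x, s)) x := by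
  obtain ⟨α, β, hα, hβ, -, hαβ, hsub⟩ := exists_Icc_nhds hI hIc hx hx
  have hK : IsCompact (Icc α β ×ˢ uIcc y₀ y) := isCompact_Icc.prod isCompact_uIcc
  have hKD : Icc α β ×ˢ uIcc y₀ y ⊆ I ×ˢ J := prod_mono hsub (hJc.uIcc_subset hy₀ hy)
  obtain ⟨C, hC⟩ := hK.exists_bound_of_continuousOn (hf'.mono hKD)
  refine (hasDerivAt_integral_of_dominated_loc_of_deriv_le (F := fun x s => f (x, s))
    (F' := fun x s => f' (x, s)) (bound := fun _ => C) (s := Icc α β)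
    (Icc_mem_nhds hα hβ) ?_ (intervalIntegrable_snd hJc hf hx hy₀ hy) ?_ ?_ (by simp) ?_).2
  · filter_upwards [hI.mem_nhds hx] with z hz
    exact (intervalIntegrable_iff.1 (intervalIntegrable_snd hJc hf hz hy₀ hy)).aestronglyMeasurable
  · exact (intervalIntegrable_iff.1 (intervalIntegrable_snd hJc hf' hx hy₀ hy)).aestronglyMeasurable
  · exact ae_of_all _ fun s hs z hz => hC (z, s) ⟨hz, uIoc_subset_uIcc hs⟩
  · exact ae_of_all _ fun s hs z hz => hd z (hsub hz) s
      (hJc.uIcc_subset hy₀ hy (uIoc_subset_uIcc hs))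

open Nat in
-- The inductive step of every factorial bound below: one integration turns the `n`-th term of an
-- exponential series into the next. It serves both existence and uniqueness.
theorem norm_integral_le_pow {g : ℝ → W} {x₀ x C M : ℝ} {n : ℕ}
    (hg : ∀ t ∈ uIcc x₀ x, ‖g t‖ ≤ C * (M * ((C * |t - x₀|) ^ n / n !))) :
    ‖∫ t in x₀..x, g t‖ ≤ M * ((C * |x - x₀|) ^ (n + 1) / (n + 1) !) := by
  rw [norm_intervalIntegral_eq]
  calc ‖∫ t in Ι x₀ x, g t‖ ≤ ∫ t in Ι x₀ x, C ^ (n + 1) * M / n ! * |t - x₀| ^ n := by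
        refine norm_integral_le_of_norm_le (Continuous.integrableOn_uIoc (by fun_prop)) ?_
        refine (ae_restrict_mem measurableSet_uIoc).mono fun t ht => ?_
        refine (hg t (uIoc_subset_uIcc ht)).trans (le_of_eq ?_)
        rw [mul_pow]; ring
    _ = M * ((C * |x - x₀|) ^ (n + 1) / (n + 1) !) := by
        rw [MeasureTheory.integral_const_mul, integral_pow_abs_sub_uIoc, Nat.factorial_succ]
        push_cast
        have : ((n ! : ℕ) : ℝ) ≠ 0 := by positivity
        have : (n : ℝ) + 1 ≠ 0 := by positivity
        rw [mul_pow]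
        field_simp

end Integrals

end PrescribedShape

/-! ### Linear total differential systems on a rectangle. -/

namespace PrescribedShape

open scoped Interval
open Set Filter Topology MeasureTheory intervalIntegral

section Partial

variable {F : Type*} [NormedAddCommGroup F] [NormedSpace ℝ F] {D : Set (ℝ × ℝ)}
  {f : ℝ × ℝ → F} {p : ℝ × ℝ}

theorem _root_.ContDiffOn.differentiableAt_of_isOpen (hf : ContDiffOn ℝ ∞ f D) (hD : IsOpen D)
    (hp : p ∈ D) : DifferentiableAt ℝ f p :=
  (hf.contDiffAt (hD.mem_nhds hp)).differentiableAt (by simp)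

theorem _root_.ContDiffOn.dx (hf : ContDiffOn ℝ ∞ f D) (hD : IsOpen D) :
    ContDiffOn ℝ ∞ (dx f) D :=
  ((contDiffOn_infty_iff_fderiv_of_isOpen hD).1 hf).2.clm_apply contDiffOn_const

theorem _root_.ContDiffOn.dy (hf : ContDiffOn ℝ ∞ f D) (hD : IsOpen D) :
    ContDiffOn ℝ ∞ (dy f) D :=
  ((contDiffOn_infty_iff_fderiv_of_isOpen hD).1 hf).2.clm_apply contDiffOn_const

theorem hasDerivAt_dx {x y : ℝ} (hf : DifferentiableAt ℝ f (x, y)) :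
    HasDerivAt (fun t => f (t, y)) (dx f (x, y)) x :=
  hf.hasFDerivAt.comp_hasDerivAt x ((hasDerivAt_id x).prodMk (hasDerivAt_const x y))

theorem hasDerivAt_dy {x y : ℝ} (hf : DifferentiableAt ℝ f (x, y)) :
    HasDerivAt (fun s => f (x, s)) (dy f (x, y)) y :=
  hf.hasFDerivAt.comp_hasDerivAt y ((hasDerivAt_const y x).prodMk (hasDerivAt_id y))

end Partial

section Volterra

variable {W : Type*} [NormedAddCommGroup W] [NormedSpace ℝ W] {I J : Set ℝ}

/-- The terms of the Picard series for `∂u/∂x = P u` with initial values `w` on the line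
`x = x₀`. -/
noncomputable def picardTerm (x₀ : ℝ) (P : ℝ × ℝ → W →L[ℝ] W) (w : ℝ → W) : ℕ → ℝ × ℝ → W
  | 0 => fun p => w p.2
  | n + 1 => fun p => ∫ t in x₀..p.1, P (t, p.2) (picardTerm x₀ P w n (t, p.2))

theorem continuousOn_picardTerm (hI : IsOpen I) (hIc : I.OrdConnected) (hJ : IsOpen J)
    (hJc : J.OrdConnected) {x₀ : ℝ} (hx₀ : x₀ ∈ I) {P : ℝ × ℝ → W →L[ℝ] W} {w : ℝ → W}
    (hP : ContinuousOn P (I ×ˢ J)) (hw : ContinuousOn w J) (n : ℕ) :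
    ContinuousOn (picardTerm x₀ P w n) (I ×ˢ J) := by
  induction n with
  | zero => exact hw.comp continuousOn_snd fun p hp => hp.2
  | succ n ih =>
    exact continuousOn_integral_fst hI hIc hJ hJc hx₀ (f := fun p => P p (picardTerm x₀ P w n p))
      (hP.clm_apply ih)

open Nat in
theorem norm_picardTerm_le {x₀ α β C M : ℝ} {s : Set ℝ} (hx₀ : x₀ ∈ Icc α β)
    {P : ℝ × ℝ → W →L[ℝ] W} {w : ℝ → W}
    (hP : ∀ p ∈ Icc α β ×ˢ s, ‖P p‖ ≤ C) (hw : ∀ y ∈ s, ‖w y‖ ≤ M) (n : ℕ) :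
    ∀ p ∈ Icc α β ×ˢ s, ‖picardTerm x₀ P w n p‖ ≤ M * ((C * |p.1 - x₀|) ^ n / n !) := by
  induction n with
  | zero => intro p hp; simpa [picardTerm] using hw p.2 hp.2
  | succ n ih =>
    intro p hp
    refine norm_integral_le_pow fun t ht => ?_
    have hmem : (t, p.2) ∈ Icc α β ×ˢ s := ⟨uIcc_subset_Icc hx₀ hp.1 ht, hp.2⟩
    exact (P (t, p.2)).le_of_opNorm_le_of_le (hP _ hmem) (ih _ hmem)

/-- The solution is the sum of the Picard series. Linearity makes the exponential bound hold on
every compact rectangle, so the solution exists on all of `I × J`, not just near `x₀`. -/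
theorem exists_volterra_solution [CompleteSpace W] (hI : IsOpen I) (hIc : I.OrdConnected)
    (hJ : IsOpen J) (hJc : J.OrdConnected) {x₀ : ℝ} (hx₀ : x₀ ∈ I) {P : ℝ × ℝ → W →L[ℝ] W}
    {w : ℝ → W} (hP : ContinuousOn P (I ×ˢ J)) (hw : ContinuousOn w J) :
    ∃ u : ℝ × ℝ → W, ContinuousOn u (I ×ˢ J) ∧
      ∀ x ∈ I, ∀ y ∈ J, u (x, y) = w y + ∫ t in x₀..x, P (t, y) (u (t, y)) := by
  have hcont := continuousOn_picardTerm hI hIc hJ hJc hx₀ hP hw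
  -- `K` is a neighbourhood of the point, for continuity of the sum, and also contains the segment
  -- from `(x₀, y)`, for integration term by term.
  have key : ∀ x ∈ I, ∀ y ∈ J, ∃ K ∈ 𝓝 (x, y), ∃ b : ℕ → ℝ, ∃ C, K ⊆ I ×ˢ J ∧ Summable b ∧
      (∀ n, ∀ p ∈ K, ‖picardTerm x₀ P w n p‖ ≤ b n) ∧ (∀ p ∈ K, ‖P p‖ ≤ C) ∧
      ∀ t ∈ uIcc x₀ x, (t, y) ∈ K := by
    intro x hx y hy
    obtain ⟨α, β, hα, hβ, h0, hαβ, hsub⟩ := exists_Icc_nhds hI hIc hx₀ hx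
    obtain ⟨c, d, hc, hd, -, hcd, hsub'⟩ := exists_Icc_nhds hJ hJc hy hy
    obtain ⟨C, hC⟩ := (isCompact_Icc.prod isCompact_Icc).exists_bound_of_continuousOn
      (hP.mono (prod_mono hsub hsub'))
    obtain ⟨M, hM⟩ := isCompact_Icc.exists_bound_of_continuousOn (hw.mono hsub')
    have hC0 : 0 ≤ C := (norm_nonneg _).trans (hC (x, y) ⟨⟨hα.le, hβ.le⟩, hc.le, hd.le⟩)
    have hM0 : 0 ≤ M := (norm_nonneg _).trans (hM y ⟨hc.le, hd.le⟩)
    refine ⟨Icc α β ×ˢ Icc c d, prod_mem_nhds (Icc_mem_nhds hα hβ) (Icc_mem_nhds hc hd), _, C,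
      prod_mono hsub hsub', (Real.summable_pow_div_factorial (C * (β - α))).mul_left M, ?_, hC,
      fun t ht => ⟨uIcc_subset_Icc h0 ⟨hα.le, hβ.le⟩ ht, hc.le, hd.le⟩⟩
    intro n p hp
    refine (norm_picardTerm_le h0 hC hM n p hp).trans ?_
    have : |p.1 - x₀| ≤ β - α := by
      rw [abs_le]; constructor <;> linarith [hp.1.1, hp.1.2, h0.1, h0.2]
    gcongr
  refine ⟨fun p => ∑' n, picardTerm x₀ P w n p, ?_, ?_⟩
  · rintro ⟨x, y⟩ ⟨hx, hy⟩
    obtain ⟨K, hK, b, C, hKD, hb, hbd, -⟩ := key x hx y hy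
    exact ((continuousOn_tsum (fun n => (hcont n).mono hKD) hb hbd).continuousAt
      hK).continuousWithinAt
  · intro x hx y hy
    obtain ⟨K, hK, b, C, hKD, hb, hbd, hPC, hseg⟩ := key x hx y hy
    have hsum : ∀ p ∈ K, Summable fun n => picardTerm x₀ P w n p := fun p hp =>
      hb.of_norm_bounded fun n => hbd n p hp
    have hint : HasSum (fun n => ∫ t in x₀..x, P (t, y) (picardTerm x₀ P w n (t, y)))
        (∫ t in x₀..x, P (t, y) (∑' n, picardTerm x₀ P w n (t, y))) := by
      refine intervalIntegral.hasSum_integral_of_dominated_convergence (fun n _ => C * b n) ?_ ?_ ?_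
        (by simp) ?_
      · intro n
        exact (intervalIntegrable_iff.1 (intervalIntegrable_fst hIc (hP.clm_apply (hcont n)) hx₀ hx
          hy)).aestronglyMeasurable
      · exact fun n => ae_of_all _ fun t ht => (P (t, y)).le_of_opNorm_le_of_le
          (hPC _ (hseg t (uIoc_subset_uIcc ht))) (hbd n _ (hseg t (uIoc_subset_uIcc ht)))
      · exact ae_of_all _ fun t _ => hb.mul_left C
      · exact ae_of_all _ fun t ht => (P (t, y)).hasSum
          (hsum _ (hseg t (uIoc_subset_uIcc ht))).hasSum
    beta_reduce
    rw [(hsum _ (mem_of_mem_nhds hK)).tsum_eq_zero_add, ← hint.tsum_eq]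
    rfl

open Nat in
-- On a compact rectangle the inner integral costs only a factor `d - c`, so iterating the equation
-- bounds `r` by `M` times the `n`-th term of an exponential series, for every `n`.
theorem volterra_eq_zero (hI : IsOpen I) (hIc : I.OrdConnected) (hJ : IsOpen J)
    (hJc : J.OrdConnected) {x₀ y₀ : ℝ} (hx₀ : x₀ ∈ I) (hy₀ : y₀ ∈ J)
    {P R : ℝ × ℝ → W →L[ℝ] W} {r : ℝ × ℝ → W} (hP : ContinuousOn P (I ×ˢ J))
    (hR : ContinuousOn R (I ×ˢ J)) (hr : ContinuousOn r (I ×ˢ J))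
    (heq : ∀ x ∈ I, ∀ y ∈ J, r (x, y) =
      ∫ t in x₀..x, (P (t, y) (r (t, y)) - ∫ s in y₀..y, R (t, s) (r (t, s)))) :
    ∀ p ∈ I ×ˢ J, r p = 0 := by
  rintro ⟨x, y⟩ ⟨hx, hy⟩
  obtain ⟨α, β, hα, hβ, hx0, hαβ, hsub⟩ := exists_Icc_nhds hI hIc hx₀ hx
  obtain ⟨c, d, hc, hd, hy0, hcd, hsub'⟩ := exists_Icc_nhds hJ hJc hy₀ hy
  have hK := (isCompact_Icc (a := α) (b := β)).prod (isCompact_Icc (a := c) (b := d))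
  have hKD := prod_mono hsub hsub'
  obtain ⟨C₁, hC₁⟩ := hK.exists_bound_of_continuousOn (hP.mono hKD)
  obtain ⟨C₂, hC₂⟩ := hK.exists_bound_of_continuousOn (hR.mono hKD)
  obtain ⟨M, hM⟩ := hK.exists_bound_of_continuousOn (hr.mono hKD)
  have hp : (x, y) ∈ Icc α β ×ˢ Icc c d := ⟨⟨hα.le, hβ.le⟩, hc.le, hd.le⟩
  have h1 : 0 ≤ C₁ := (norm_nonneg _).trans (hC₁ _ hp)
  have h2 : 0 ≤ C₂ := (norm_nonneg _).trans (hC₂ _ hp)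
  have hM0 : 0 ≤ M := (norm_nonneg _).trans (hM _ hp)
  have hdc : 0 ≤ d - c := sub_nonneg.2 hcd
  have hC0 : 0 ≤ C₁ + C₂ * (d - c) := by positivity
  have bound : ∀ n : ℕ, ∀ p ∈ Icc α β ×ˢ Icc c d,
      ‖r p‖ ≤ M * (((C₁ + C₂ * (d - c)) * |p.1 - x₀|) ^ n / n !) := by
    intro n
    induction n with
    | zero => intro p hp; simpa using hM p hp
    | succ n ih =>
      rintro ⟨x, y⟩ ⟨hx, hy⟩
      simp only at hx hy
      rw [heq x (hsub hx) y (hsub' hy)]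
      refine norm_integral_le_pow fun t ht => ?_
      have ht' : t ∈ Icc α β := uIcc_subset_Icc hx0 hx ht
      set b := M * (((C₁ + C₂ * (d - c)) * |t - x₀|) ^ n / n !) with hb
      have hb0 : 0 ≤ b := by positivity
      have hI1 : ‖P (t, y) (r (t, y))‖ ≤ C₁ * b :=
        (P (t, y)).le_of_opNorm_le_of_le (hC₁ _ ⟨ht', hy⟩) (ih _ ⟨ht', hy⟩)
      have hI2 : ‖∫ s in y₀..y, R (t, s) (r (t, s))‖ ≤ C₂ * b * |y - y₀| := by
        refine norm_integral_le_of_norm_le_const fun s hs => ?_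
        have hs' : s ∈ Icc c d := uIcc_subset_Icc hy0 hy (uIoc_subset_uIcc hs)
        exact (R (t, s)).le_of_opNorm_le_of_le (hC₂ _ ⟨ht', hs'⟩) (ih _ ⟨ht', hs'⟩)
      have hI3 : |y - y₀| ≤ d - c := by
        rw [abs_le]; constructor <;> linarith [hy.1, hy.2, hy0.1, hy0.2]
      calc _ ≤ C₁ * b + C₂ * b * |y - y₀| := (norm_sub_le _ _).trans (add_le_add hI1 hI2)
        _ ≤ C₁ * b + C₂ * b * (d - c) := by gcongr
        _ = _ := by ring
  have hlim := (FloorSemiring.tendsto_pow_div_factorial_atTop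
    ((C₁ + C₂ * (d - c)) * |x - x₀|)).const_mul M
  rw [mul_zero] at hlim
  exact norm_le_zero_iff.1 (ge_of_tendsto' hlim fun n => bound n (x, y) hp)

end Volterra

section Frobenius

variable {W : Type*} [NormedAddCommGroup W] [NormedSpace ℝ W] [CompleteSpace W] {I J : Set ℝ}

/-- A linear total differential system `∂u/∂x = P u`, `∂u/∂y = Q u` on a rectangle that satisfies
the integrability condition has a solution with any given initial value. -/
theorem exists_continuous_solution_of_flat (hI : IsOpen I) (hIc : I.OrdConnected) (hJ : IsOpen J)
    (hJc : J.OrdConnected) {x₀ y₀ : ℝ} (hx₀ : x₀ ∈ I) (hy₀ : y₀ ∈ J)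
    {P Q P' Q' : ℝ × ℝ → W →L[ℝ] W} (hP : ContinuousOn P (I ×ˢ J)) (hQ : ContinuousOn Q (I ×ˢ J))
    (hP' : ContinuousOn P' (I ×ˢ J)) (hQ' : ContinuousOn Q' (I ×ˢ J))
    (hPy : ∀ x ∈ I, ∀ y ∈ J, HasDerivAt (fun s => P (x, s)) (P' (x, y)) y)
    (hQx : ∀ x ∈ I, ∀ y ∈ J, HasDerivAt (fun t => Q (t, y)) (Q' (x, y)) x)
    (hflat : ∀ p ∈ I ×ˢ J, ∀ v, P' p v + P p (Q p v) = Q' p v + Q p (P p v)) (v₀ : W) :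
    ∃ u : ℝ × ℝ → W, u (x₀, y₀) = v₀ ∧ ContinuousOn u (I ×ˢ J) ∧
      (∀ x ∈ I, ∀ y ∈ J, HasDerivAt (fun t => u (t, y)) (P (x, y) (u (x, y))) x) ∧
      ∀ x ∈ I, ∀ y ∈ J, HasDerivAt (fun s => u (x, s)) (Q (x, y) (u (x, y))) y := by
  obtain ⟨w, hw, hweq⟩ : ∃ w : ℝ → W, ContinuousOn w J ∧
      ∀ y ∈ J, w y = v₀ + ∫ s in y₀..y, Q (x₀, s) (w s) := by
    -- The equation along the line `x = x₀` has one variable; the second coordinate is idle here.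
    obtain ⟨u, hu, hueq⟩ := exists_volterra_solution hJ hJc hJ hJc hy₀
      (P := fun p => Q (x₀, p.1)) (w := fun _ => v₀)
      (hQ.comp (by fun_prop) fun p hp => ⟨hx₀, hp.1⟩) continuousOn_const
    exact ⟨fun y => u (y, y₀), hu.comp (by fun_prop) fun y hy => ⟨hy, hy₀⟩,
      fun y hy => hueq y hy y₀ hy₀⟩
  obtain ⟨u, hu, hueq⟩ := exists_volterra_solution hI hIc hJ hJc hx₀ hP hw
  have hPu := hP.clm_apply hu
  have hQu := hQ.clm_apply hu
  have hux : ∀ x ∈ I, ∀ y ∈ J, HasDerivAt (fun t => u (t, y)) (P (x, y) (u (x, y))) x := by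
    intro x hx y hy
    refine ((hasDerivAt_integral_fst hI hIc hPu hx₀ hx hy).const_add (w y)).congr_of_eventuallyEq ?_
    filter_upwards [hI.mem_nhds hx] with t ht using hueq t ht y hy
  have hu0 : ∀ y ∈ J, u (x₀, y) = w y := fun y hy => by simp [hueq x₀ hx₀ y hy]
  have hw0 : w y₀ = v₀ := by simp [hweq y₀ hy₀]
  -- `u` solves the `x`-equation but is not yet known to be differentiable in `y`. By construction
  -- `v` has `y`-derivative `Q u`, so it suffices to prove `u = v`.
  set v : ℝ × ℝ → W := fun p => u (p.1, y₀) + ∫ s in y₀..p.2, Q (p.1, s) (u (p.1, s)) with hv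
  have hvc : ContinuousOn v (I ×ˢ J) :=
    (hu.comp (by fun_prop) fun p hp => ⟨hp.1, hy₀⟩).add
      (continuousOn_integral_snd hI hIc hJ hJc hy₀ hQu)
  have hvy : ∀ x ∈ I, ∀ y ∈ J, HasDerivAt (fun s => v (x, s)) (Q (x, y) (u (x, y))) y :=
    fun x hx y hy => (hasDerivAt_integral_snd hJ hJc hQu hx hy₀ hy).const_add (u (x, y₀))
  set G : ℝ × ℝ → W := fun p => Q' p (u p) + Q p (P p (u p)) with hG
  have hGc : ContinuousOn G (I ×ˢ J) := (hQ'.clm_apply hu).add (hQ.clm_apply hPu)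
  have hvx : ∀ x ∈ I, ∀ y ∈ J, HasDerivAt (fun t => v (t, y))
      (P (x, y₀) (u (x, y₀)) + ∫ s in y₀..y, G (x, s)) x := fun x hx y hy =>
    (hux x hx y₀ hy₀).add (hasDerivAt_integral_param hI hIc hJc hQu hGc
      (fun x hx y hy => (hQx x hx y hy).clm_apply (hux x hx y hy)) hx hy₀ hy)
  have hv0 : ∀ x ∈ I, v (x, y₀) = u (x, y₀) := fun x _ => by simp [hv]
  -- `P v` expressed through its derivative in the second variable
  have hPv : ∀ x ∈ I, ∀ y ∈ J, ∫ s in y₀..y, (P' (x, s) (v (x, s)) + P (x, s) (Q (x, s) (u (x, s))))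
      = P (x, y) (v (x, y)) - P (x, y₀) (u (x, y₀)) := by
    intro x hx y hy
    rw [← hv0 x hx]
    refine integral_eq_sub_of_hasDerivAt (f := fun s => P (x, s) (v (x, s))) (fun s hs => ?_) ?_
    · have hs' := hJc.uIcc_subset hy₀ hy hs
      exact (hPy x hx s hs').clm_apply (hvy x hx s hs')
    · exact intervalIntegrable_snd hJc ((hP'.clm_apply hvc).add (hP.clm_apply hQu)) hx hy₀ hy
  -- By flatness `r = u - v` satisfies `r_x = P r - ∫ P' r` and vanishes on `x = x₀`, which is a
  -- homogeneous Volterra equation.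
  have hr : ∀ p ∈ I ×ˢ J, u p - v p = 0 := by
    refine volterra_eq_zero hI hIc hJ hJc hx₀ hy₀ hP hP' (hu.sub hvc) fun x hx y hy => ?_
    have hx0 : u (x₀, y) - v (x₀, y) = 0 := by
      have : ∫ s in y₀..y, Q (x₀, s) (u (x₀, s)) = ∫ s in y₀..y, Q (x₀, s) (w s) :=
        integral_congr fun s hs => by
          simp only [hu0 s (hJc.uIcc_subset hy₀ hy hs)]
      simp only [hv, this, hu0 y hy, hu0 y₀ hy₀, hw0, hweq y hy, sub_self]
    have hderiv : ∀ t ∈ I, HasDerivAt (fun t => u (t, y) - v (t, y)) (P (t, y) (u (t, y) - v (t, y))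
        - ∫ s in y₀..y, P' (t, s) (u (t, s) - v (t, s))) t := by
      intro t ht
      refine ((hux t ht y hy).sub (hvx t ht y hy)).congr_deriv ?_
      have i1 : IntervalIntegrable (fun s => P' (t, s) (u (t, s) - v (t, s))) volume y₀ y :=
        intervalIntegrable_snd hJc (hP'.clm_apply (hu.sub hvc)) ht hy₀ hy
      have i2 : IntervalIntegrable
          (fun s => P' (t, s) (v (t, s)) + P (t, s) (Q (t, s) (u (t, s)))) volume y₀ y :=
        intervalIntegrable_snd hJc ((hP'.clm_apply hvc).add (hP.clm_apply hQu)) ht hy₀ hy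
      have e1 : ∫ s in y₀..y, G (t, s) = (∫ s in y₀..y, P' (t, s) (u (t, s) - v (t, s))) +
          ∫ s in y₀..y, (P' (t, s) (v (t, s)) + P (t, s) (Q (t, s) (u (t, s)))) := by
        rw [← integral_add i1 i2]
        refine integral_congr fun s hs => ?_
        simp only [hG]
        rw [← hflat (t, s) ⟨ht, hJc.uIcc_subset hy₀ hy hs⟩, map_sub]
        abel
      rw [e1, hPv t ht y hy, map_sub]
      abel
    have hcont : ContinuousOn (fun p : ℝ × ℝ => P p (u p - v p) -
        ∫ s in y₀..p.2, P' (p.1, s) (u (p.1, s) - v (p.1, s))) (I ×ˢ J) :=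
      (hP.clm_apply (hu.sub hvc)).sub
        (continuousOn_integral_snd hI hIc hJ hJc hy₀ (hP'.clm_apply (hu.sub hvc)))
    have := integral_eq_sub_of_hasDerivAt (fun t ht => hderiv t (hIc.uIcc_subset hx₀ hx ht))
      (intervalIntegrable_fst hIc hcont hx₀ hx hy)
    rw [hx0, sub_zero] at this
    exact this.symm
  refine ⟨u, by rw [hu0 y₀ hy₀, hw0], hu, hux, fun x hx y hy => ?_⟩
  refine (hvy x hx y hy).congr_of_eventuallyEq ?_
  filter_upwards [hJ.mem_nhds hy] with s hs using sub_eq_zero.1 (hr (x, s) ⟨hx, hs⟩)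

/-- The smooth version of `exists_continuous_solution_of_flat`. -/
theorem exists_smooth_solution_of_flat (hI : IsOpen I) (hIc : I.OrdConnected) (hJ : IsOpen J)
    (hJc : J.OrdConnected) {p₀ : ℝ × ℝ} (hp₀ : p₀ ∈ I ×ˢ J) {P Q : ℝ × ℝ → W →L[ℝ] W}
    (hP : ContDiffOn ℝ ∞ P (I ×ˢ J)) (hQ : ContDiffOn ℝ ∞ Q (I ×ˢ J))
    (hflat : ∀ p ∈ I ×ˢ J, ∀ v, dy P p v + P p (Q p v) = dx Q p v + Q p (P p v)) (v₀ : W) :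
    ∃ u : ℝ × ℝ → W, u p₀ = v₀ ∧ ContDiffOn ℝ ∞ u (I ×ˢ J) ∧
      (∀ p ∈ I ×ˢ J, dx u p = P p (u p)) ∧ ∀ p ∈ I ×ˢ J, dy u p = Q p (u p) := by
  have hD : IsOpen (I ×ˢ J) := hI.prod hJ
  obtain ⟨u, hu0, hu, hux, huy⟩ := exists_continuous_solution_of_flat hI hIc hJ hJc hp₀.1 hp₀.2
    hP.continuousOn hQ.continuousOn (hP.dy hD).continuousOn (hQ.dx hD).continuousOn
    (fun x hx y hy => hasDerivAt_dy (hP.differentiableAt_of_isOpen hD ⟨hx, hy⟩))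
    (fun x hx y hy => hasDerivAt_dx (hQ.differentiableAt_of_isOpen hD ⟨hx, hy⟩)) hflat v₀
  set L₁ := ContinuousLinearMap.smulRightL ℝ (ℝ × ℝ) W (ContinuousLinearMap.fst ℝ ℝ ℝ)
  set L₂ := ContinuousLinearMap.smulRightL ℝ (ℝ × ℝ) W (ContinuousLinearMap.snd ℝ ℝ ℝ)
  have hfd : ∀ p ∈ I ×ˢ J, HasFDerivAt u (L₁ (P p (u p)) + L₂ (Q p (u p))) p := by
    intro p hp
    have hev : ∀ᶠ q in 𝓝 p, q ∈ I ×ˢ J := hD.mem_nhds hp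
    have hPu := (hP.continuousOn.clm_apply hu).continuousAt (hD.mem_nhds hp)
    have hQu := (hQ.continuousOn.clm_apply hu).continuousAt (hD.mem_nhds hp)
    have := (hasStrictFDerivAt_uncurry_coprod (𝕜 := ℝ) (u := p) (f := fun x y => u (x, y))
      (f₁ := fun x y => ContinuousLinearMap.toSpanSingleton ℝ (P (x, y) (u (x, y))))
      (f₂ := fun x y => ContinuousLinearMap.toSpanSingleton ℝ (Q (x, y) (u (x, y))))
      (hev.mono fun q hq => (hux q.1 hq.1 q.2 hq.2).hasFDerivAt)
      (hev.mono fun q hq => (huy q.1 hq.1 q.2 hq.2).hasFDerivAt)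
      ((ContinuousLinearMap.toSpanSingletonCLE (𝕜 := ℝ)).continuous.continuousAt.comp hPu)
      ((ContinuousLinearMap.toSpanSingletonCLE (𝕜 := ℝ)).continuous.continuousAt.comp
        hQu)).hasFDerivAt
    refine this.congr_fderiv ?_
    ext <;> simp [L₁, L₂, Function.HasUncurry.uncurry]
  have hdiff : DifferentiableOn ℝ u (I ×ˢ J) := fun p hp =>
    (hfd p hp).differentiableAt.differentiableWithinAt
  refine ⟨u, hu0, ?_, fun p hp => ?_, fun p hp => ?_⟩
  -- Bootstrapping: the derivative of `u` is smooth in the coefficients and linear in `u`, so each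
  -- order of smoothness yields the next.
  · refine contDiffOn_infty.2 fun n => ?_
    induction n with
    | zero => exact contDiffOn_zero.2 hu
    | succ n ih =>
      push_cast
      rw [contDiffOn_succ_iff_fderiv_of_isOpen hD]
      refine ⟨hdiff, by simp, ?_⟩
      refine ContDiffOn.congr ?_ fun p hp => (hfd p hp).fderiv
      have hn : ((n : ℕ∞) : WithTop ℕ∞) ≤ ∞ := by exact_mod_cast le_top
      exact (L₁.contDiff.comp_contDiffOn ((hP.of_le hn).clm_apply ih)).add
        (L₂.contDiff.comp_contDiffOn ((hQ.of_le hn).clm_apply ih))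
  · simp [dx, (hfd p hp).fderiv, L₁, L₂]
  · simp [dy, (hfd p hp).fderiv, L₁, L₂]

end Frobenius

end PrescribedShape

/-! ### Derivative rules, and the system rewritten as Codazzi and Gauss equations. -/

namespace PrescribedShape

open Set Filter Topology

section Calculus

variable {F : Type*} [NormedAddCommGroup F] [NormedSpace ℝ F] {p v : ℝ × ℝ}

theorem fderiv_congr_of_eqOn {D : Set (ℝ × ℝ)} (hD : IsOpen D) {f g : ℝ × ℝ → F}
    (h : ∀ z ∈ D, f z = g z) (hp : p ∈ D) : fderiv ℝ f p = fderiv ℝ g p :=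
  Filter.EventuallyEq.fderiv_eq (by filter_upwards [hD.mem_nhds hp] with z hz using h z hz)

theorem fderiv_smul_apply' {f : ℝ × ℝ → ℝ} {g : ℝ × ℝ → F} (hf : DifferentiableAt ℝ f p)
    (hg : DifferentiableAt ℝ g p) :
    fderiv ℝ (fun z => f z • g z) p v = fderiv ℝ f p v • g p + f p • fderiv ℝ g p v := by
  rw [fderiv_fun_smul hf hg]
  simp [add_comm]

theorem fderiv_add_apply' {f g : ℝ × ℝ → F} (hf : DifferentiableAt ℝ f p)
    (hg : DifferentiableAt ℝ g p) :
    fderiv ℝ (fun z => f z + g z) p v = fderiv ℝ f p v + fderiv ℝ g p v := by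
  rw [fderiv_fun_add hf hg]
  simp

theorem fderiv_mul_apply' {f g : ℝ × ℝ → ℝ} (hf : DifferentiableAt ℝ f p)
    (hg : DifferentiableAt ℝ g p) :
    fderiv ℝ (fun z => f z * g z) p v = fderiv ℝ f p v * g p + f p * fderiv ℝ g p v := by
  rw [fderiv_fun_mul hf hg]
  simp; ring

theorem fderiv_div_apply' {f g : ℝ × ℝ → ℝ} (hf : DifferentiableAt ℝ f p)
    (hg : DifferentiableAt ℝ g p) (h0 : g p ≠ 0) :
    fderiv ℝ (fun z => f z / g z) p v =
      (fderiv ℝ f p v * g p - f p * fderiv ℝ g p v) / g p ^ 2 := by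
  have hd : DifferentiableAt ℝ (fun z => f z / g z) p := by
    simp only [div_eq_mul_inv]
    exact hf.mul (hg.inv h0)
  have hev : (fun z => f z / g z * g z) =ᶠ[𝓝 p] f := by
    filter_upwards [hg.continuousAt.eventually_ne h0] with z hz using div_mul_cancel₀ _ hz
  have h := fderiv_mul_apply' (v := v) hd hg
  rw [hev.fderiv_eq] at h
  rw [h]
  field_simp
  ring

theorem dx_dy_comm {D : Set (ℝ × ℝ)} (hD : IsOpen D) {f : ℝ × ℝ → F} (hf : ContDiffOn ℝ ∞ f D)
    (hp : p ∈ D) : dx (dy f) p = dy (dx f) p := by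
  have h2 : IsSymmSndFDerivAt ℝ f p :=
    (hf.contDiffAt (hD.mem_nhds hp)).isSymmSndFDerivAt (by
      rw [minSmoothness_of_isRCLikeNormedField]
      exact WithTop.coe_le_coe.2 (le_top : (2 : ℕ∞) ≤ ⊤))
  have h1 : DifferentiableAt ℝ (fderiv ℝ f) p :=
    ((contDiffOn_infty_iff_fderiv_of_isOpen hD).1 hf).2.differentiableAt_of_isOpen hD hp
  have e : ∀ v w : ℝ × ℝ, fderiv ℝ (fun z => fderiv ℝ f z v) p w = fderiv ℝ (fderiv ℝ f) p w v := by
    intro v w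
    rw [fderiv_clm_apply h1 (differentiableAt_const v)]
    simp
  exact (e _ _).trans ((h2 _ _).trans (e _ _).symm)

end Calculus

/-- The function `B_x / (A - B)`. -/
noncomputable def ratioX (A B : ℝ × ℝ → ℝ) (z : ℝ × ℝ) : ℝ := dx B z / (A z - B z)

/-- The function `-A_y / (A - B)`. -/
noncomputable def ratioY (A B : ℝ × ℝ → ℝ) (z : ℝ × ℝ) : ℝ := -dy A z / (A z - B z)

section Ratio

variable {D : Set (ℝ × ℝ)} (hD : IsOpen D) {A B : ℝ × ℝ → ℝ} (hA : ContDiffOn ℝ ∞ A D)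
  (hB : ContDiffOn ℝ ∞ B D) (hAB : ∀ p ∈ D, B p < A p)
include hD hA hB hAB

theorem contDiffOn_ratioX : ContDiffOn ℝ ∞ (ratioX A B) D :=
  (hB.dx hD).div (hA.sub hB) fun z hz => (sub_pos.2 (hAB z hz)).ne'

theorem contDiffOn_ratioY : ContDiffOn ℝ ∞ (ratioY A B) D :=
  (hA.dy hD).neg.div (hA.sub hB) fun z hz => (sub_pos.2 (hAB z hz)).ne'

omit hD hA hB in
theorem dx_eq_ratioX {z : ℝ × ℝ} (hz : z ∈ D) : dx B z = ratioX A B z * (A z - B z) := by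
  rw [ratioX, div_mul_cancel₀ _ (sub_pos.2 (hAB z hz)).ne']

omit hD hA hB in
theorem dy_eq_ratioY {z : ℝ × ℝ} (hz : z ∈ D) : dy A z = -ratioY A B z * (A z - B z) := by
  rw [ratioY, neg_mul, div_mul_cancel₀ _ (sub_pos.2 (hAB z hz)).ne', neg_neg]

theorem dx_dx_eq {z : ℝ × ℝ} (hz : z ∈ D) :
    dx (dx B) z = dx (ratioX A B) z * (A z - B z) + ratioX A B z * (dx A z - dx B z) := by
  have dA := hA.differentiableAt_of_isOpen hD hz
  have dB := hB.differentiableAt_of_isOpen hD hz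
  have dp := (contDiffOn_ratioX hD hA hB hAB).differentiableAt_of_isOpen hD hz
  have := fderiv_congr_of_eqOn hD (fun z hz => dx_eq_ratioX hAB hz) hz
  change fderiv ℝ (dx B) z (1, 0) = fderiv ℝ _ z (1, 0) * _ + _ * (fderiv ℝ A z (1, 0) - fderiv ℝ B z (1, 0))
  rw [this, fderiv_mul_apply' dp (dA.fun_sub dB), fderiv_fun_sub dA dB]
  simp

theorem dy_dy_eq {z : ℝ × ℝ} (hz : z ∈ D) :
    dy (dy A) z = -dy (ratioY A B) z * (A z - B z) - ratioY A B z * (dy A z - dy B z) := by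
  have dA := hA.differentiableAt_of_isOpen hD hz
  have dB := hB.differentiableAt_of_isOpen hD hz
  have dp := (contDiffOn_ratioY hD hA hB hAB).differentiableAt_of_isOpen hD hz
  have := fderiv_congr_of_eqOn hD (fun z hz => dy_eq_ratioY hAB hz) hz
  change fderiv ℝ (dy A) z (0, 1) = -fderiv ℝ _ z (0, 1) * _ - _ * (fderiv ℝ A z (0, 1) - fderiv ℝ B z (0, 1))
  rw [this, fderiv_mul_apply' dp.fun_neg (dA.fun_sub dB), fderiv_fun_sub dA dB, fderiv_fun_neg]
  simp
  ring

/-- The system in the form of the Codazzi and Gauss equations. -/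
theorem solvesSystem_iff {a b : ℝ × ℝ → ℝ} (ha : ContDiffOn ℝ ∞ a D) (hb : ContDiffOn ℝ ∞ b D) :
    SolvesSystem A B D a b ↔ ∀ z ∈ D, dy a z = -2 * ratioY A B z * a z ∧
      dx b z = -2 * ratioX A B z * b z ∧
      -(A z * B z) = (dx (ratioX A B) z + ratioX A B z ^ 2) * a z + ratioX A B z * dx a z / 2
        + (dy (ratioY A B) z + ratioY A B z ^ 2) * b z + ratioY A B z * dy b z / 2 := by
  have h1 : ∀ z, 2 * dy A z / (A z - B z) * a z = -2 * ratioY A B z * a z := fun z => by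
    rw [ratioY]; ring
  have h2 : ∀ z, 2 * dx B z / (B z - A z) * b z = -2 * ratioX A B z * b z := fun z => by
    rw [ratioX, ← neg_sub (A z), div_neg]; ring
  have h3 : ∀ z ∈ D, (-2 * A z * B z * (A z - B z) ^ 2 =
      (A z - B z) * dx B z * dx a z
        - 2 * (dx B z * dx A z - 2 * dx B z ^ 2 + (B z - A z) * dx (dx B) z) * a z
        + (B z - A z) * dy A z * dy b z
        - 2 * (dy A z * dy B z - 2 * dy A z ^ 2 + (A z - B z) * dy (dy A) z) * b z) ↔
      -(A z * B z) = (dx (ratioX A B) z + ratioX A B z ^ 2) * a z + ratioX A B z * dx a z / 2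
        + (dy (ratioY A B) z + ratioY A B z ^ 2) * b z + ratioY A B z * dy b z / 2 := by
    intro z hz
    -- The two forms of the third equation differ exactly by this factor.
    have h0 : 2 * (A z - B z) ^ 2 ≠ 0 := by
      have := sub_pos.2 (hAB z hz)
      positivity
    rw [dx_dx_eq hD hA hB hAB hz, dy_dy_eq hD hA hB hAB hz, dx_eq_ratioX hAB hz,
      dy_eq_ratioY hAB hz]
    refine ⟨fun h => mul_left_cancel₀ h0 ?_, fun h => ?_⟩
    · linear_combination h
    · linear_combination 2 * (A z - B z) ^ 2 * h
  constructor
  · intro h z hz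
    exact ⟨(h.eq_a z hz).trans (h1 z), (h.eq_b z hz).trans (h2 z), (h3 z hz).1 (h.eq_ab z hz)⟩
  · intro h
    exact ⟨ha, hb, fun z hz => (h z hz).1.trans (h1 z).symm,
      fun z hz => (h z hz).2.1.trans (h2 z).symm, fun z hz => (h3 z hz).2 (h z hz).2.2⟩

end Ratio

/-! ### Orthogonal frames and rigidity. -/

section OrthogonalFrame

theorem sum_inner_div_smul_eq {e : Fin 3 → E3} (h0 : ∀ i, e i ≠ 0)
    (ho : ∀ i j, i ≠ j → inner ℝ (e i) (e j) = 0) (w : E3) :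
    ∑ j, (inner ℝ (e j) w / inner ℝ (e j) (e j)) • e j = w := by
  have hli : LinearIndependent ℝ e := linearIndependent_of_ne_zero_of_inner_eq_zero h0 ho
  let b := basisOfLinearIndependentOfCardEqFinrank hli (by simp)
  refine ext_inner_left ℝ fun v => ?_
  rw [← b.sum_repr v, sum_inner, sum_inner]
  refine Finset.sum_congr rfl fun i _ => ?_
  rw [inner_smul_left, inner_smul_left]
  congr 1
  simp only [b, coe_basisOfLinearIndependentOfCardEqFinrank, inner_sum, inner_smul_right]
  rw [Finset.sum_eq_single i (fun j _ hj => by rw [ho i j hj.symm, mul_zero]) (by simp)]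
  exact div_mul_cancel₀ _ (inner_self_ne_zero.2 (h0 i))

theorem inner_eq_sum {e : Fin 3 → E3} (h0 : ∀ i, e i ≠ 0)
    (ho : ∀ i j, i ≠ j → inner ℝ (e i) (e j) = 0) (z w : E3) :
    inner ℝ z w = ∑ j, inner ℝ (e j) z * inner ℝ (e j) w / inner ℝ (e j) (e j) := by
  conv_lhs => rw [← sum_inner_div_smul_eq h0 ho w]
  simp only [inner_sum, inner_smul_right]
  refine Finset.sum_congr rfl fun j _ => ?_
  rw [real_inner_comm z]; ring

/-- Two frame fields with the same Gram matrices and the same connection coefficients differ by a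
fixed linear isometry. -/
theorem exists_isometry_of_gram_eq {D : Set (ℝ × ℝ)} (hD : IsOpen D) (hDc : IsPreconnected D)
    {f g : Fin 3 → ℝ × ℝ → E3} (hf : ∀ i, DifferentiableOn ℝ (f i) D)
    (hg : ∀ i, DifferentiableOn ℝ (g i) D) (h0 : ∀ i, ∀ p ∈ D, f i p ≠ 0)
    (ho : ∀ i j, i ≠ j → ∀ p ∈ D, inner ℝ (f i p) (f j p) = 0)
    (hgram : ∀ i j, ∀ p ∈ D, inner ℝ (f i p) (f j p) = inner ℝ (g i p) (g j p))
    (hconn : ∀ i j, ∀ p ∈ D, ∀ v,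
      inner ℝ (f j p) (fderiv ℝ (f i) p v) = inner ℝ (g j p) (fderiv ℝ (g i) p v)) :
    ∃ L : E3 ≃ₗᵢ[ℝ] E3, ∀ p ∈ D, ∀ i, L (f i p) = g i p := by
  rcases D.eq_empty_or_nonempty with rfl | ⟨p₀, hp₀⟩
  · exact ⟨LinearIsometryEquiv.refl ℝ E3, by simp⟩
  have h0' : ∀ i, ∀ p ∈ D, g i p ≠ 0 := fun i p hp => by
    rw [← inner_self_ne_zero (𝕜 := ℝ), ← hgram i i p hp, inner_self_ne_zero]
    exact h0 i p hp
  have ho' : ∀ i j, i ≠ j → ∀ p ∈ D, inner ℝ (g i p) (g j p) = 0 := fun i j hij p hp => by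
    rw [← hgram i j p hp, ho i j hij p hp]
  have hfd : ∀ i, ∀ p ∈ D, DifferentiableAt ℝ (f i) p := fun i p hp =>
    (hf i).differentiableAt (hD.mem_nhds hp)
  have hgd : ∀ i, ∀ p ∈ D, DifferentiableAt ℝ (g i) p := fun i p hp =>
    (hg i).differentiableAt (hD.mem_nhds hp)
  -- The linear map carrying `f j p` to `g j p`, written explicitly so that it is differentiable in
  -- `p`. The aim is that it is constant.
  set T : ℝ × ℝ → E3 →L[ℝ] E3 := fun p =>
    ∑ j, (inner ℝ (f j p) (f j p))⁻¹ •
      (ContinuousLinearMap.smulRightL ℝ E3 E3 (innerSL ℝ (f j p)) (g j p)) with hT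
  have hTapp : ∀ p w, T p w = ∑ j, (inner ℝ (f j p) w / inner ℝ (f j p) (f j p)) • g j p := by
    intro p w
    simp only [hT, sum_apply, smul_apply, ContinuousLinearMap.smulRightL_apply_apply,
      ContinuousLinearMap.smulRight_apply, smul_smul, innerSL_apply_apply]
    exact Finset.sum_congr rfl fun j _ => by rw [div_eq_inv_mul]
  have hTd : ∀ p ∈ D, DifferentiableAt ℝ T p := by
    intro p hp
    refine DifferentiableAt.fun_sum fun j _ => ?_
    refine (((hfd j p hp).inner ℝ (hfd j p hp)).inv (inner_self_ne_zero.2 (h0 j p hp))).smul ?_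
    refine DifferentiableAt.clm_apply ?_ (hgd j p hp)
    exact ((ContinuousLinearMap.smulRightL ℝ E3 E3).differentiableAt).comp p
      ((innerSL ℝ).differentiableAt.comp p (hfd j p hp))
  have hTf : ∀ p ∈ D, ∀ i, T p (f i p) = g i p := by
    intro p hp i
    rw [hTapp, Finset.sum_eq_single i (fun j _ hj => by rw [ho j i hj p hp, zero_div, zero_smul])
      (by simp), div_self (inner_self_ne_zero.2 (h0 i p hp)), one_smul]
  -- Equal connection coefficients mean that the derivatives have equal coordinates in the two
  -- frames. Differentiating `T f = g` then leaves only the derivative of `T` applied to `f`, which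
  -- must vanish.
  have hTdf : ∀ p ∈ D, ∀ i v, T p (fderiv ℝ (f i) p v) = fderiv ℝ (g i) p v := by
    intro p hp i v
    rw [hTapp, ← sum_inner_div_smul_eq (fun j => h0' j p hp) (fun j k hjk => ho' j k hjk p hp)
      (fderiv ℝ (g i) p v)]
    simp only [hconn i _ p hp v, hgram _ _ p hp]
  have hTd0 : ∀ p ∈ D, fderiv ℝ T p = 0 := by
    intro p hp
    refine ContinuousLinearMap.ext fun v => ?_
    have key : ∀ i, fderiv ℝ T p v (f i p) = 0 := by
      intro i
      have h1 := fderiv_congr_of_eqOn hD (fun z hz => hTf z hz i) hp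
      rw [fderiv_clm_apply (hTd p hp) (hfd i p hp)] at h1
      have h2 := DFunLike.congr_fun h1 v
      simpa [hTdf p hp i v] using h2
    refine ContinuousLinearMap.ext fun w => ?_
    rw [← sum_inner_div_smul_eq (fun j => h0 j p hp) (fun j k hjk => ho j k hjk p hp) w]
    simp [key]
  have hTc : ∀ p ∈ D, T p = T p₀ := fun p hp =>
    hD.is_const_of_fderiv_eq_zero hDc (fun z hz => (hTd z hz).differentiableWithinAt)
      (fun z hz => hTd0 z hz) hp hp₀
  have hinner : ∀ z w, inner ℝ (T p₀ z) (T p₀ w) = inner ℝ z w := by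
    intro z w
    rw [inner_eq_sum (fun j => h0 j p₀ hp₀) (fun j k hjk => ho j k hjk p₀ hp₀) z w,
      inner_eq_sum (fun j => h0' j p₀ hp₀) (fun j k hjk => ho' j k hjk p₀ hp₀)]
    have hg : ∀ j w, inner ℝ (g j p₀) (T p₀ w) = inner ℝ (f j p₀) w := by
      intro j w
      rw [hTapp, inner_sum, Finset.sum_eq_single j (fun k _ hk => by
        rw [inner_smul_right, ho' j k hk.symm p₀ hp₀, mul_zero]) (by simp), inner_smul_right,
        ← hgram j j p₀ hp₀, div_mul_cancel₀ _ (inner_self_ne_zero.2 (h0 j p₀ hp₀))]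
    simp only [hg, hgram _ _ p₀ hp₀]
  let L : E3 →ₗᵢ[ℝ] E3 := (T p₀).toLinearMap.isometryOfInner hinner
  refine ⟨L.toLinearIsometryEquiv rfl, fun p hp i => ?_⟩
  rw [← hTf p hp i, hTc p hp]
  rfl

end OrthogonalFrame

end PrescribedShape

/-! ### Structure equations of a realization. -/

namespace PrescribedShape

open Set Filter Topology

theorem eq_of_inner_frame_eq {e : Fin 3 → E3} (h0 : ∀ i, e i ≠ 0)
    (ho : ∀ i j, i ≠ j → inner ℝ (e i) (e j) = 0) {z w : E3}
    (h : ∀ j, inner ℝ (e j) z = inner ℝ (e j) w) : z = w := by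
  rw [← sum_inner_div_smul_eq h0 ho z, ← sum_inner_div_smul_eq h0 ho w]
  simp only [h]

theorem fderiv_apply_eq_dx_dy {F : Type*} [NormedAddCommGroup F] [NormedSpace ℝ F]
    (f : ℝ × ℝ → F) (p v : ℝ × ℝ) : fderiv ℝ f p v = v.1 • dx f p + v.2 • dy f p := by
  rw [dx, dy, ← map_smul, ← map_smul, ← map_add]
  congr 1
  ext <;> simp

theorem fderiv_inner_self {f : ℝ × ℝ → E3} {p : ℝ × ℝ} (hf : DifferentiableAt ℝ f p)
    (v : ℝ × ℝ) :
    fderiv ℝ (fun z => inner ℝ (f z) (f z)) p v = 2 * inner ℝ (f p) (fderiv ℝ f p v) := by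
  rw [fderiv_inner_apply ℝ hf hf, real_inner_comm (f p), two_mul]

theorem inner_fderiv_of_orthogonal {D : Set (ℝ × ℝ)} (hD : IsOpen D) {f g : ℝ × ℝ → E3}
    (h : ∀ z ∈ D, inner ℝ (f z) (g z) = 0) {p : ℝ × ℝ} (hp : p ∈ D) (hf : DifferentiableAt ℝ f p)
    (hg : DifferentiableAt ℝ g p) (v : ℝ × ℝ) :
    inner ℝ (f p) (fderiv ℝ g p v) = -inner ℝ (g p) (fderiv ℝ f p v) := by
  have h1 := DFunLike.congr_fun (fderiv_congr_of_eqOn hD (g := fun _ => (0 : ℝ)) h hp) v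
  rw [fderiv_inner_apply ℝ hf hg, fderiv_fun_const] at h1
  simp only [Pi.zero_apply, zero_apply] at h1
  rw [real_inner_comm (g p)] at h1
  linarith

namespace Realization

variable {D : Set (ℝ × ℝ)} {A B : ℝ × ℝ → ℝ}

/-- The squared length of the first coordinate vector field. -/
noncomputable def normSqX (r : Realization D (shapeOp A B)) (z : ℝ × ℝ) : ℝ :=
  inner ℝ (dx r.X z) (dx r.X z)

/-- The squared length of the second coordinate vector field. -/
noncomputable def normSqY (r : Realization D (shapeOp A B)) (z : ℝ × ℝ) : ℝ :=
  inner ℝ (dy r.X z) (dy r.X z)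

/-- The coordinate vector fields together with the unit normal. -/
noncomputable def frame (r : Realization D (shapeOp A B)) : Fin 3 → ℝ × ℝ → E3 :=
  ![dx r.X, dy r.X, r.N]

section Pointwise

variable (r : Realization D (shapeOp A B)) {p : ℝ × ℝ} (hp : p ∈ D)
include hp

theorem normSqX_pos : 0 < r.normSqX p := by
  refine real_inner_self_pos.2 fun h => ?_
  have := r.immersion p hp (h.trans (map_zero (fderiv ℝ r.X p)).symm)
  simp at this

theorem normSqY_pos : 0 < r.normSqY p := by
  refine real_inner_self_pos.2 fun h => ?_
  have := r.immersion p hp (h.trans (map_zero (fderiv ℝ r.X p)).symm)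
  simp at this

omit hp in
theorem fderiv_shapeOp_fst : fderiv ℝ r.X p (shapeOp A B p (1, 0)) = A p • dx r.X p := by
  rw [fderiv_apply_eq_dx_dy]; simp [shapeOp]

omit hp in
theorem fderiv_shapeOp_snd : fderiv ℝ r.X p (shapeOp A B p (0, 1)) = B p • dy r.X p := by
  rw [fderiv_apply_eq_dx_dy]; simp [shapeOp]

/-- Eigenvectors of a self-adjoint operator for distinct eigenvalues are orthogonal. -/
theorem inner_dx_dy (hAB : B p < A p) : inner ℝ (dx r.X p) (dy r.X p) = 0 := by
  have h := r.shape p hp (1, 0) (0, 1)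
  have h2 := h.1.symm.trans h.2
  simp only [firstForm] at h2
  rw [r.fderiv_shapeOp_fst, r.fderiv_shapeOp_snd, inner_smul_left, inner_smul_right] at h2
  have h3 : (A p - B p) * inner ℝ (dx r.X p) (dy r.X p) = 0 := by
    simp only [dx, dy, conj_trivial] at h2 ⊢
    linarith
  exact (mul_eq_zero.1 h3).resolve_left (sub_pos.2 hAB).ne'

theorem inner_N_dx : inner ℝ (r.N p) (dx r.X p) = 0 := r.normal p hp _

theorem inner_N_dy : inner ℝ (r.N p) (dy r.X p) = 0 := r.normal p hp _

theorem frame_ne_zero (i : Fin 3) : r.frame i p ≠ 0 := by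
  fin_cases i
  · exact inner_self_ne_zero.1 (r.normSqX_pos hp).ne'
  · exact inner_self_ne_zero.1 (r.normSqY_pos hp).ne'
  · refine (inner_self_ne_zero (𝕜 := ℝ)).1 ?_
    exact (r.unit p hp).trans_ne one_ne_zero

theorem inner_frame (hAB : B p < A p) (i j : Fin 3) (hij : i ≠ j) :
    inner ℝ (r.frame i p) (r.frame j p) = 0 := by
  have h1 := r.inner_dx_dy hp hAB
  have h2 := r.inner_N_dx hp
  have h3 := r.inner_N_dy hp
  have h1' := h1
  have h2' := h2
  have h3' := h3
  rw [real_inner_comm] at h1' h2' h3'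
  fin_cases i <;> fin_cases j <;> first | exact absurd rfl hij | assumption

end Pointwise

variable (hD : IsOpen D) (hA : ContDiffOn ℝ ∞ A D) (hB : ContDiffOn ℝ ∞ B D)
  (hAB : ∀ p ∈ D, B p < A p) (r : Realization D (shapeOp A B)) {p : ℝ × ℝ} (hp : p ∈ D)
include hD hp

omit hp in
theorem contDiffOn_frame (i : Fin 3) : ContDiffOn ℝ ∞ (r.frame i) D := by
  fin_cases i
  · exact r.smooth_X.dx hD
  · exact r.smooth_X.dy hD
  · exact r.smooth_N

theorem inner_N_fderiv_N (v : ℝ × ℝ) : inner ℝ (r.N p) (fderiv ℝ r.N p v) = 0 := by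
  have dN := r.smooth_N.differentiableAt_of_isOpen hD hp
  have h := DFunLike.congr_fun (fderiv_congr_of_eqOn hD (g := fun _ => (1 : ℝ)) r.unit hp) v
  rw [fderiv_inner_self dN, fderiv_fun_const] at h
  simpa using h

include hAB in
-- Weingarten equation: `N` has constant length, so its derivative is tangent, and the tangential
-- components are read off from the second form.
theorem dx_N : dx r.N p = -A p • dx r.X p := by
  refine eq_of_inner_frame_eq (r.frame_ne_zero hp) (r.inner_frame hp (hAB p hp)) fun j => ?_
  rw [inner_smul_right]
  fin_cases j
  · have h := (r.shape p hp (1, 0) (1, 0)).1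
    simp only [secondForm, firstForm] at h
    rw [r.fderiv_shapeOp_fst, inner_smul_right] at h
    change inner ℝ (dx r.X p) _ = -A p * inner ℝ (dx r.X p) _
    rw [real_inner_comm]
    simp only [dx] at h ⊢
    linarith
  · have h := (r.shape p hp (1, 0) (0, 1)).1
    simp only [secondForm, firstForm] at h
    rw [r.fderiv_shapeOp_snd, inner_smul_right] at h
    have h0 := r.inner_dx_dy hp (hAB p hp)
    change inner ℝ (dy r.X p) _ = -A p * inner ℝ (dy r.X p) _
    rw [real_inner_comm, real_inner_comm (dx r.X p), h0]
    simp only [dx, dy] at h h0 ⊢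
    rw [h0] at h
    linarith
  · change inner ℝ (r.N p) _ = -A p * inner ℝ (r.N p) _
    rw [r.inner_N_dx hp, mul_zero]
    exact r.inner_N_fderiv_N hD hp _

include hAB in
theorem dy_N : dy r.N p = -B p • dy r.X p := by
  refine eq_of_inner_frame_eq (r.frame_ne_zero hp) (r.inner_frame hp (hAB p hp)) fun j => ?_
  rw [inner_smul_right]
  fin_cases j
  · have h := (r.shape p hp (0, 1) (1, 0)).1
    simp only [secondForm, firstForm] at h
    rw [r.fderiv_shapeOp_fst, inner_smul_right] at h
    have h0 := r.inner_dx_dy hp (hAB p hp)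
    change inner ℝ (dx r.X p) _ = -B p * inner ℝ (dx r.X p) _
    rw [h0]
    rw [real_inner_comm] at h0 ⊢
    simp only [dx, dy] at h h0 ⊢
    rw [h0] at h
    linarith
  · have h := (r.shape p hp (0, 1) (0, 1)).1
    simp only [secondForm, firstForm] at h
    rw [r.fderiv_shapeOp_snd, inner_smul_right] at h
    change inner ℝ (dy r.X p) _ = -B p * inner ℝ (dy r.X p) _
    rw [real_inner_comm]
    simp only [dy] at h ⊢
    linarith
  · change inner ℝ (r.N p) _ = -B p * inner ℝ (r.N p) _
    rw [r.inner_N_dy hp, mul_zero]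
    exact r.inner_N_fderiv_N hD hp _

include hA hB hAB

/-- The Codazzi equations in vector form: equate the mixed derivatives of `N` obtained from the two
Weingarten equations and divide by `A - B`. -/
theorem dy_dx_X :
    dy (dx r.X) p = ratioY A B p • dx r.X p + ratioX A B p • dy r.X p := by
  have dA := hA.differentiableAt_of_isOpen hD hp
  have dB := hB.differentiableAt_of_isOpen hD hp
  have dXx := (r.smooth_X.dx hD).differentiableAt_of_isOpen hD hp
  have dXy := (r.smooth_X.dy hD).differentiableAt_of_isOpen hD hp
  have h1 : dy (dx r.N) p = -dy A p • dx r.X p + -A p • dy (dx r.X) p := by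
    have := DFunLike.congr_fun
      (fderiv_congr_of_eqOn hD (fun z hz => r.dx_N hD hAB hz) hp) ((0, 1) : ℝ × ℝ)
    rw [fderiv_smul_apply' dA.fun_neg dXx, fderiv_fun_neg] at this
    exact this
  have h2 : dx (dy r.N) p = -dx B p • dy r.X p + -B p • dy (dx r.X) p := by
    have := DFunLike.congr_fun
      (fderiv_congr_of_eqOn hD (fun z hz => r.dy_N hD hAB hz) hp) ((1, 0) : ℝ × ℝ)
    rw [fderiv_smul_apply' dB.fun_neg dXy, fderiv_fun_neg] at this
    rw [← dx_dy_comm hD r.smooth_X hp]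
    exact this
  rw [dx_dy_comm hD r.smooth_N hp, h1, dy_eq_ratioY hAB hp, dx_eq_ratioX hAB hp] at h2
  have h0 := (sub_pos.2 (hAB p hp)).ne'
  refine smul_right_injective E3 h0 ?_
  simp only
  linear_combination (norm := module) (-1 : ℝ) • h2

/-- Every entry depends only on `A`, `B`, their derivatives, and the two squared lengths with their
derivatives. Rigidity rests on this. The entries not given directly come from differentiating
orthogonality relations. -/
theorem inner_frame_dx (i j : Fin 3) : inner ℝ (r.frame j p) (dx (r.frame i) p) =
    ![![dx r.normSqX p / 2, -ratioY A B p * r.normSqX p, A p * r.normSqX p],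
      ![ratioY A B p * r.normSqX p, ratioX A B p * r.normSqY p, 0],
      ![-A p * r.normSqX p, 0, 0]] i j := by
  have dXx := (r.smooth_X.dx hD).differentiableAt_of_isOpen hD hp
  have dXy := (r.smooth_X.dy hD).differentiableAt_of_isOpen hD hp
  have dN := r.smooth_N.differentiableAt_of_isOpen hD hp
  have hx := r.dx_N hD hAB hp
  have hxy := r.dy_dx_X hD hA hB hAB hp
  have hyx := (dx_dy_comm hD r.smooth_X hp).trans hxy
  have o1 := r.inner_dx_dy hp (hAB p hp)
  have o1' := (real_inner_comm _ _).trans o1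
  have o2 := r.inner_N_dx hp
  have o3 := r.inner_N_dy hp
  have o2' := (real_inner_comm _ _).trans o2
  have o3' := (real_inner_comm _ _).trans o3
  fin_cases i <;> fin_cases j
  · change inner ℝ (dx r.X p) (dx (dx r.X) p) = dx r.normSqX p / 2
    have : dx r.normSqX p = 2 * inner ℝ (dx r.X p) (dx (dx r.X) p) := fderiv_inner_self dXx _
    linarith
  · change inner ℝ (dy r.X p) (dx (dx r.X) p) = -ratioY A B p * r.normSqX p
    refine (inner_fderiv_of_orthogonal hD (fun z hz => (real_inner_comm _ _).trans
      (r.inner_dx_dy hz (hAB z hz))) hp dXy dXx _).trans ?_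
    change -inner ℝ (dx r.X p) (dx (dy r.X) p) = _
    rw [hyx, inner_add_right, inner_smul_right, inner_smul_right, o1, normSqX]
    ring
  · change inner ℝ (r.N p) (dx (dx r.X) p) = A p * r.normSqX p
    refine (inner_fderiv_of_orthogonal hD (fun z hz => r.inner_N_dx hz) hp dN dXx _).trans ?_
    change -inner ℝ (dx r.X p) (dx r.N p) = _
    rw [hx, inner_smul_right, normSqX]
    ring
  · change inner ℝ (dx r.X p) (dx (dy r.X) p) = ratioY A B p * r.normSqX p
    rw [hyx, inner_add_right, inner_smul_right, inner_smul_right, o1, normSqX]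
    ring
  · change inner ℝ (dy r.X p) (dx (dy r.X) p) = ratioX A B p * r.normSqY p
    rw [hyx, inner_add_right, inner_smul_right, inner_smul_right, o1', normSqY]
    ring
  · change inner ℝ (r.N p) (dx (dy r.X) p) = 0
    rw [hyx, inner_add_right, inner_smul_right, inner_smul_right, o2, o3]
    ring
  · change inner ℝ (dx r.X p) (dx r.N p) = -A p * r.normSqX p
    rw [hx, inner_smul_right, normSqX]
  · change inner ℝ (dy r.X p) (dx r.N p) = 0
    rw [hx, inner_smul_right, o1', mul_zero]
  · exact r.inner_N_fderiv_N hD hp _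

theorem inner_frame_dy (i j : Fin 3) : inner ℝ (r.frame j p) (dy (r.frame i) p) =
    ![![ratioY A B p * r.normSqX p, ratioX A B p * r.normSqY p, 0],
      ![-ratioX A B p * r.normSqY p, dy r.normSqY p / 2, B p * r.normSqY p],
      ![0, -B p * r.normSqY p, 0]] i j := by
  have dXx := (r.smooth_X.dx hD).differentiableAt_of_isOpen hD hp
  have dXy := (r.smooth_X.dy hD).differentiableAt_of_isOpen hD hp
  have dN := r.smooth_N.differentiableAt_of_isOpen hD hp
  have hy := r.dy_N hD hAB hp
  have hxy := r.dy_dx_X hD hA hB hAB hp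
  have o1 := r.inner_dx_dy hp (hAB p hp)
  have o1' := (real_inner_comm _ _).trans o1
  have o2 := r.inner_N_dx hp
  have o3 := r.inner_N_dy hp
  fin_cases i <;> fin_cases j
  · change inner ℝ (dx r.X p) (dy (dx r.X) p) = ratioY A B p * r.normSqX p
    rw [hxy, inner_add_right, inner_smul_right, inner_smul_right, o1, normSqX]
    ring
  · change inner ℝ (dy r.X p) (dy (dx r.X) p) = ratioX A B p * r.normSqY p
    rw [hxy, inner_add_right, inner_smul_right, inner_smul_right, o1', normSqY]
    ring
  · change inner ℝ (r.N p) (dy (dx r.X) p) = 0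
    rw [hxy, inner_add_right, inner_smul_right, inner_smul_right, o2, o3]
    ring
  · change inner ℝ (dx r.X p) (dy (dy r.X) p) = -ratioX A B p * r.normSqY p
    refine (inner_fderiv_of_orthogonal hD (fun z hz => r.inner_dx_dy hz (hAB z hz)) hp dXx dXy
      _).trans ?_
    change -inner ℝ (dy r.X p) (dy (dx r.X) p) = _
    rw [hxy, inner_add_right, inner_smul_right, inner_smul_right, o1', normSqY]
    ring
  · change inner ℝ (dy r.X p) (dy (dy r.X) p) = dy r.normSqY p / 2
    have : dy r.normSqY p = 2 * inner ℝ (dy r.X p) (dy (dy r.X) p) := fderiv_inner_self dXy _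
    linarith
  · change inner ℝ (r.N p) (dy (dy r.X) p) = B p * r.normSqY p
    refine (inner_fderiv_of_orthogonal hD (fun z hz => r.inner_N_dy hz) hp dN dXy _).trans ?_
    change -inner ℝ (dy r.X p) (dy r.N p) = _
    rw [hy, inner_smul_right, normSqY]
    ring
  · change inner ℝ (dx r.X p) (dy r.N p) = 0
    rw [hy, inner_smul_right, o1, mul_zero]
  · change inner ℝ (dy r.X p) (dy r.N p) = -B p * r.normSqY p
    rw [hy, inner_smul_right, normSqY]
  · exact r.inner_N_fderiv_N hD hp _

theorem dy_normSqX : dy r.normSqX p = 2 * (ratioY A B p * r.normSqX p) := by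
  have dXx := (r.smooth_X.dx hD).differentiableAt_of_isOpen hD hp
  exact (fderiv_inner_self dXx (0, 1)).trans
    (congrArg (2 * ·) (r.inner_frame_dy hD hA hB hAB hp 0 0))

theorem dx_normSqY : dx r.normSqY p = 2 * (ratioX A B p * r.normSqY p) := by
  have dXy := (r.smooth_X.dy hD).differentiableAt_of_isOpen hD hp
  exact (fderiv_inner_self dXy (1, 0)).trans
    (congrArg (2 * ·) (r.inner_frame_dx hD hA hB hAB hp 1 1))

omit hp hA hB hAB in
theorem contDiffOn_normSqX : ContDiffOn ℝ ∞ r.normSqX D :=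
  (r.smooth_X.dx hD).inner ℝ (r.smooth_X.dx hD)

omit hp hA hB hAB in
theorem contDiffOn_normSqY : ContDiffOn ℝ ∞ r.normSqY D :=
  (r.smooth_X.dy hD).inner ℝ (r.smooth_X.dy hD)

/-- The Gauss equation. -/
theorem gauss_equation :
    (dx (ratioX A B) p + ratioX A B p ^ 2) * r.normSqY p
      + (dy (ratioY A B) p + ratioY A B p ^ 2) * r.normSqX p
      = ratioX A B p * r.normSqY p * dx r.normSqX p / (2 * r.normSqX p)
        + ratioY A B p * r.normSqX p * dy r.normSqY p / (2 * r.normSqY p)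
        - A p * B p * r.normSqX p * r.normSqY p := by
  have hXx := r.smooth_X.dx hD
  have hXy := r.smooth_X.dy hD
  have dXx := hXx.differentiableAt_of_isOpen hD hp
  have dXy := hXy.differentiableAt_of_isOpen hD hp
  have dXxx := (hXx.dx hD).differentiableAt_of_isOpen hD hp
  have dP := (contDiffOn_ratioX hD hA hB hAB).differentiableAt_of_isOpen hD hp
  have dQ := (contDiffOn_ratioY hD hA hB hAB).differentiableAt_of_isOpen hD hp
  have dE := (r.contDiffOn_normSqX hD).differentiableAt_of_isOpen hD hp
  have hE := (r.normSqX_pos hp).ne'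
  have hG := (r.normSqY_pos hp).ne'
  have cX := fun z hz => r.inner_frame_dx hD hA hB hAB (p := z) hz
  have cY := fun z hz => r.inner_frame_dy hD hA hB hAB (p := z) hz
  -- The Gauss equation arises from computing `⟨X_y, X_xxy⟩` twice: by differentiating the formula
  -- for `X_xy` in `x`, and by differentiating `⟨X_y, X_xx⟩ = -qE` in `y`. The second way leaves
  -- `⟨X_yy, X_xx⟩`, expanded in the frame in `e5`; its normal part supplies the term with `A B`.
  have e1 : dx (dy (dx r.X)) p = (dx (ratioY A B) p • dx r.X p + ratioY A B p • dx (dx r.X) p)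
      + (dx (ratioX A B) p • dy r.X p + ratioX A B p • dx (dy r.X) p) := by
    have := DFunLike.congr_fun (fderiv_congr_of_eqOn hD
      (fun z hz => r.dy_dx_X hD hA hB hAB hz) hp) ((1, 0) : ℝ × ℝ)
    rw [fderiv_add_apply' (dQ.fun_smul dXx) (dP.fun_smul dXy), fderiv_smul_apply' dQ dXx,
      fderiv_smul_apply' dP dXy] at this
    exact this
  have e2 : inner ℝ (dy r.X p) (dx (dy (dx r.X)) p) =
      ratioY A B p * (-ratioY A B p * r.normSqX p) + dx (ratioX A B) p * r.normSqY p
        + ratioX A B p * (ratioX A B p * r.normSqY p) := by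
    have c01 : inner ℝ (dy r.X p) (dx (dx r.X) p) = _ := cX p hp 0 1
    have c11 : inner ℝ (dy r.X p) (dx (dy r.X) p) = _ := cX p hp 1 1
    have o := (real_inner_comm _ _).trans (r.inner_dx_dy hp (hAB p hp))
    rw [e1]
    simp only [inner_add_right, inner_smul_right]
    rw [c01, c11, o, ← normSqY]
    simp
    ring
  have e3 : dy (fun z => -ratioY A B z * r.normSqX z) p =
      inner ℝ (dy r.X p) (dy (dx (dx r.X)) p) + inner ℝ (dy (dy r.X) p) (dx (dx r.X) p) := by
    have := DFunLike.congr_fun (fderiv_congr_of_eqOn hD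
      (fun z hz => (show inner ℝ (dy r.X z) (dx (dx r.X) z) = _ from cX z hz 0 1)) hp)
      ((0, 1) : ℝ × ℝ)
    rw [fderiv_inner_apply ℝ dXy dXxx] at this
    exact this.symm
  have e4 : dy (fun z => -ratioY A B z * r.normSqX z) p =
      -dy (ratioY A B) p * r.normSqX p - ratioY A B p * (2 * (ratioY A B p * r.normSqX p)) := by
    have : dy (fun z => -ratioY A B z * r.normSqX z) p = _ :=
      fderiv_mul_apply' (v := ((0, 1) : ℝ × ℝ)) dQ.fun_neg dE
    rw [this, fderiv_fun_neg, ← r.dy_normSqX hD hA hB hAB hp]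
    simp only [dy, neg_apply]
    ring
  have e5 : inner ℝ (dy (dy r.X) p) (dx (dx r.X) p) =
      -ratioX A B p * r.normSqY p * (dx r.normSqX p / 2) / r.normSqX p
      + (dy r.normSqY p / 2) * (-ratioY A B p * r.normSqX p) / r.normSqY p
      + (B p * r.normSqY p) * (A p * r.normSqX p) := by
    have u : inner ℝ (r.frame 2 p) (r.frame 2 p) = (1 : ℝ) := r.unit p hp
    have c0 : inner ℝ (r.frame 0 p) (dx (dx r.X) p) = _ := cX p hp 0 0
    have c1 : inner ℝ (r.frame 1 p) (dx (dx r.X) p) = _ := cX p hp 0 1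
    have c2 : inner ℝ (r.frame 2 p) (dx (dx r.X) p) = _ := cX p hp 0 2
    have d0 : inner ℝ (r.frame 0 p) (dy (dy r.X) p) = _ := cY p hp 1 0
    have d1 : inner ℝ (r.frame 1 p) (dy (dy r.X) p) = _ := cY p hp 1 1
    have d2 : inner ℝ (r.frame 2 p) (dy (dy r.X) p) = _ := cY p hp 1 2
    rw [inner_eq_sum (r.frame_ne_zero hp) (r.inner_frame hp (hAB p hp)), Fin.sum_univ_three,
      c0, c1, c2, d0, d1, d2, u, div_one]
    rfl
  rw [← dx_dy_comm hD hXx hp, e2, e5, e4] at e3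
  field_simp at e3 ⊢
  linear_combination -e3

end Realization

end PrescribedShape

/-! ### From realizations to solutions, congruence, and the affine space. -/

namespace PrescribedShape

open Set Filter Topology

theorem dx_one_div {f : ℝ × ℝ → ℝ} {p : ℝ × ℝ} (hf : DifferentiableAt ℝ f p) (h0 : f p ≠ 0) :
    dx (fun z => 1 / f z) p = -dx f p / f p ^ 2 := by
  refine (fderiv_div_apply' (differentiableAt_const 1) hf h0).trans ?_
  simp [dx]

theorem dy_one_div {f : ℝ × ℝ → ℝ} {p : ℝ × ℝ} (hf : DifferentiableAt ℝ f p) (h0 : f p ≠ 0) :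
    dy (fun z => 1 / f z) p = -dy f p / f p ^ 2 := by
  refine (fderiv_div_apply' (differentiableAt_const 1) hf h0).trans ?_
  simp [dy]

namespace Realization

variable {D : Set (ℝ × ℝ)} {A B : ℝ × ℝ → ℝ}

/-- Passing to reciprocals linearizes the problem: after division by `EG`, the quotients `E_x / E²`
and `G_y / G²` in the Gauss equation are `-a_x` and `-b_y`. -/
theorem solvesSystem (hD : IsOpen D) (hA : ContDiffOn ℝ ∞ A D) (hB : ContDiffOn ℝ ∞ B D)
    (hAB : ∀ p ∈ D, B p < A p) (r : Realization D (shapeOp A B)) :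
    SolvesSystem A B D (fun z => 1 / r.normSqX z) (fun z => 1 / r.normSqY z) := by
  have cE := r.contDiffOn_normSqX hD
  have cG := r.contDiffOn_normSqY hD
  have ca : ContDiffOn ℝ ∞ (fun z => 1 / r.normSqX z) D :=
    contDiffOn_const.div cE fun z hz => (r.normSqX_pos hz).ne'
  have cb : ContDiffOn ℝ ∞ (fun z => 1 / r.normSqY z) D :=
    contDiffOn_const.div cG fun z hz => (r.normSqY_pos hz).ne'
  refine (solvesSystem_iff hD hA hB hAB ca cb).2 fun p hp => ?_
  have hE := (r.normSqX_pos hp).ne'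
  have hG := (r.normSqY_pos hp).ne'
  have dE := cE.differentiableAt_of_isOpen hD hp
  have dG := cG.differentiableAt_of_isOpen hD hp
  have gauss := r.gauss_equation hD hA hB hAB hp
  rw [dx_one_div dE hE, dy_one_div dE hE, dx_one_div dG hG, dy_one_div dG hG,
    r.dy_normSqX hD hA hB hAB hp, r.dx_normSqY hD hA hB hAB hp]
  refine ⟨by field_simp, by field_simp, ?_⟩
  field_simp at gauss ⊢
  linear_combination -gauss

/-- The frames are related by a constant isometry `L`; then `s.X - L ∘ r.X` has zero derivative, and
its constant value is the translation. -/
theorem congruent_of_normSq_eq (hD : IsOpen D) (hDc : IsPreconnected D)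
    (hA : ContDiffOn ℝ ∞ A D) (hB : ContDiffOn ℝ ∞ B D) (hAB : ∀ p ∈ D, B p < A p)
    (r s : Realization D (shapeOp A B)) (hX : ∀ p ∈ D, r.normSqX p = s.normSqX p)
    (hY : ∀ p ∈ D, r.normSqY p = s.normSqY p) : Congruent r s := by
  have hdX : ∀ p ∈ D, dx r.normSqX p = dx s.normSqX p := fun p hp =>
    DFunLike.congr_fun (fderiv_congr_of_eqOn hD hX hp) _
  have hdY : ∀ p ∈ D, dy r.normSqY p = dy s.normSqY p := fun p hp =>
    DFunLike.congr_fun (fderiv_congr_of_eqOn hD hY hp) _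
  have dr := fun i => (r.contDiffOn_frame hD i).differentiableOn (by simp)
  have ds := fun i => (s.contDiffOn_frame hD i).differentiableOn (by simp)
  obtain ⟨L, hL⟩ := exists_isometry_of_gram_eq hD hDc dr ds
    (fun i p hp => r.frame_ne_zero hp i) (fun i j hij p hp => r.inner_frame hp (hAB p hp) i j hij)
    (fun i j p hp => by
      rcases eq_or_ne i j with rfl | hij
      · fin_cases i
        · exact hX p hp
        · exact hY p hp
        · exact (r.unit p hp).trans (s.unit p hp).symm
      · rw [r.inner_frame hp (hAB p hp) i j hij, s.inner_frame hp (hAB p hp) i j hij])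
    (fun i j p hp v => by
      simp only [fderiv_apply_eq_dx_dy (frame _ i), inner_add_right, inner_smul_right,
        r.inner_frame_dx hD hA hB hAB hp, r.inner_frame_dy hD hA hB hAB hp,
        s.inner_frame_dx hD hA hB hAB hp, s.inner_frame_dy hD hA hB hAB hp,
        hX p hp, hY p hp, hdX p hp, hdY p hp])
  have dXr : ∀ p ∈ D, DifferentiableAt ℝ r.X p := fun p hp =>
    r.smooth_X.differentiableAt_of_isOpen hD hp
  have dXs : ∀ p ∈ D, DifferentiableAt ℝ s.X p := fun p hp =>
    s.smooth_X.differentiableAt_of_isOpen hD hp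
  have dL : ∀ p ∈ D, HasFDerivAt (fun z => L (r.X z))
      ((L.toContinuousLinearEquiv : E3 →L[ℝ] E3).comp (fderiv ℝ r.X p)) p := fun p hp =>
    (L.toContinuousLinearEquiv : E3 →L[ℝ] E3).hasFDerivAt.comp p (dXr p hp).hasFDerivAt
  obtain ⟨c, hc⟩ := hD.exists_is_const_of_fderiv_eq_zero hDc
    (f := fun z => s.X z - L (r.X z))
    (fun p hp => ((dXs p hp).sub (dL p hp).differentiableAt).differentiableWithinAt)
    (fun p hp => by
      rw [fderiv_fun_sub (dXs p hp) (dL p hp).differentiableAt, (dL p hp).fderiv]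
      refine ContinuousLinearMap.ext fun v => ?_
      have h0 : L (dx r.X p) = dx s.X p := hL p hp 0
      have h1 : L (dy r.X p) = dy s.X p := hL p hp 1
      simp [fderiv_apply_eq_dx_dy, h0, h1])
  refine ⟨L.toAffineIsometryEquiv.trans (AffineIsometryEquiv.constVAdd ℝ E3 c), fun p hp =>
    ⟨?_, (hL p hp 2).symm⟩⟩
  have := hc p hp
  simp only [AffineIsometryEquiv.coe_trans, Function.comp_apply,
    LinearIsometryEquiv.coe_toAffineIsometryEquiv, AffineIsometryEquiv.coe_constVAdd, vadd_eq_add]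
  rw [← this, sub_add_cancel]

theorem coeffs_eq_of_congruent (hD : IsOpen D) {S : ℝ × ℝ → (ℝ × ℝ →L[ℝ] ℝ × ℝ)}
    {r s : Realization D S} (h : Congruent r s) : r.coeffs = s.coeffs := by
  obtain ⟨g, hg⟩ := h
  have hform : ∀ p ∈ D, ∀ v w, firstForm s.X p v w = firstForm r.X p v w := by
    intro p hp v w
    have dr := (r.smooth_X.differentiableAt_of_isOpen hD hp).hasFDerivAt
    have hgd : HasFDerivAt g (g.linearIsometryEquiv.toContinuousLinearEquiv : E3 →L[ℝ] E3)
        (r.X p) := by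
      have : (g : E3 → E3) = fun z => g.linearIsometryEquiv z + g 0 := by
        funext z
        have := g.map_vadd 0 z
        simpa using this
      rw [this]
      exact (ContinuousLinearMap.hasFDerivAt
        (g.linearIsometryEquiv.toContinuousLinearEquiv : E3 →L[ℝ] E3)).add_const _
    have hs : fderiv ℝ s.X p = _ :=
      (fderiv_congr_of_eqOn hD (fun z hz => (hg z hz).1) hp).trans (hgd.comp p dr).fderiv
    rw [firstForm, firstForm, hs]
    exact g.linearIsometryEquiv.inner_map_map _ _
  refine Prod.ext ?_ ?_ <;> funext p <;> simp only [coeffs, hform p.1 p.2]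

end Realization

/-- The weights `c`, `-c`, `1` sum to one, so the inhomogeneous term is reproduced. -/
theorem SolvesSystem.lineMap {A B : ℝ × ℝ → ℝ} {D : Set (ℝ × ℝ)} (hD : IsOpen D)
    {a₁ b₁ a₂ b₂ a₃ b₃ : ℝ × ℝ → ℝ} (h₁ : SolvesSystem A B D a₁ b₁)
    (h₂ : SolvesSystem A B D a₂ b₂) (h₃ : SolvesSystem A B D a₃ b₃) (c : ℝ) :
    SolvesSystem A B D (fun z => c * (a₁ z - a₂ z) + a₃ z) (fun z => c * (b₁ z - b₂ z) + b₃ z) := by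
  have key : ∀ {f₁ f₂ f₃ : ℝ × ℝ → ℝ}, ContDiffOn ℝ ∞ f₁ D → ContDiffOn ℝ ∞ f₂ D →
      ContDiffOn ℝ ∞ f₃ D → ∀ p ∈ D, ∀ v, fderiv ℝ (fun z => c * (f₁ z - f₂ z) + f₃ z) p v =
        c * (fderiv ℝ f₁ p v - fderiv ℝ f₂ p v) + fderiv ℝ f₃ p v := by
    intro f₁ f₂ f₃ c₁ c₂ c₃ p hp v
    have d₁ := c₁.differentiableAt_of_isOpen hD hp
    have d₂ := c₂.differentiableAt_of_isOpen hD hp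
    have d₃ := c₃.differentiableAt_of_isOpen hD hp
    rw [fderiv_add_apply' ((d₁.fun_sub d₂).const_mul c) d₃, fderiv_const_mul (d₁.fun_sub d₂),
      fderiv_fun_sub d₁ d₂]
    simp
  have ka := key h₁.smooth_a h₂.smooth_a h₃.smooth_a
  have kb := key h₁.smooth_b h₂.smooth_b h₃.smooth_b
  refine ⟨(contDiffOn_const.mul (h₁.smooth_a.sub h₂.smooth_a)).add h₃.smooth_a,
    (contDiffOn_const.mul (h₁.smooth_b.sub h₂.smooth_b)).add h₃.smooth_b,
    fun p hp => ?_, fun p hp => ?_, fun p hp => ?_⟩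
  · have e₁ := h₁.eq_a p hp
    have e₂ := h₂.eq_a p hp
    have e₃ := h₃.eq_a p hp
    refine (ka p hp (0, 1)).trans ?_
    simp only [dy] at e₁ e₂ e₃ ⊢
    linear_combination c * (e₁ - e₂) + e₃
  · have e₁ := h₁.eq_b p hp
    have e₂ := h₂.eq_b p hp
    have e₃ := h₃.eq_b p hp
    refine (kb p hp (1, 0)).trans ?_
    simp only [dx] at e₁ e₂ e₃ ⊢
    linear_combination c * (e₁ - e₂) + e₃
  · have e₁ := h₁.eq_ab p hp
    have e₂ := h₂.eq_ab p hp
    have e₃ := h₃.eq_ab p hp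
    have ex : dx (fun z => c * (a₁ z - a₂ z) + a₃ z) p = c * (dx a₁ p - dx a₂ p) + dx a₃ p :=
      ka p hp (1, 0)
    have ey : dy (fun z => c * (b₁ z - b₂ z) + b₃ z) p = c * (dy b₁ p - dy b₂ p) + dy b₃ p :=
      kb p hp (0, 1)
    rw [ex, ey]
    linear_combination c * (e₁ - e₂) + e₃

/-- The affine space of solutions of the system. -/
noncomputable def solutionSpace (A B : ℝ × ℝ → ℝ) {D : Set (ℝ × ℝ)} (hD : IsOpen D) :
    AffineSubspace ℝ ((D → ℝ) × (D → ℝ)) where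
  carrier := solutionSet A B D
  smul_vsub_vadd_mem' := by
    rintro c _ _ _ ⟨a₁, b₁, h₁, rfl⟩ ⟨a₂, b₂, h₂, rfl⟩ ⟨a₃, b₃, h₃, rfl⟩
    exact ⟨_, _, SolvesSystem.lineMap hD h₁ h₂ h₃ c, rfl⟩

end PrescribedShape

/-! ### Integration of the Gauss-Weingarten equations. -/

namespace PrescribedShape

open Set Filter Topology

section Matrix

variable {W : Type*} [NormedAddCommGroup W] [NormedSpace ℝ W] {n : ℕ}

/-- The action of square matrices on tuples of vectors. -/
noncomputable def matrixAction (n : ℕ) (W : Type*) [NormedAddCommGroup W] [NormedSpace ℝ W] :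
    (Fin n → Fin n → ℝ) →L[ℝ] (Fin n → W) →L[ℝ] (Fin n → W) :=
  LinearMap.toContinuousLinearMap
    { toFun := fun m => ContinuousLinearMap.pi fun i =>
        ∑ j, m i j • (ContinuousLinearMap.proj j : (Fin n → W) →L[ℝ] W)
      map_add' := fun m m' => by
        ext v i
        simp [add_smul, Finset.sum_add_distrib]
      map_smul' := fun c m => by
        ext v i
        simp [mul_smul, Finset.smul_sum] }

theorem matrixAction_apply (m : Fin n → Fin n → ℝ) (v : Fin n → W) (i : Fin n) :
    matrixAction n W m v i = ∑ j, m i j • v j := by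
  simp [matrixAction]

theorem matrixAction_matrixAction (m m' : Fin n → Fin n → ℝ) (v : Fin n → W) :
    matrixAction n W m (matrixAction n W m' v) =
      matrixAction n W (fun i j => ∑ k, m i k * m' k j) v := by
  funext i
  simp only [matrixAction_apply, Finset.smul_sum, Finset.sum_smul, smul_smul]
  exact Finset.sum_comm

theorem fderiv_matrixAction {m : ℝ × ℝ → Fin n → Fin n → ℝ} {p : ℝ × ℝ}
    (hm : ∀ i j, DifferentiableAt ℝ (fun z => m z i j) p) (v : ℝ × ℝ) :
    fderiv ℝ (fun z => matrixAction n W (m z)) p v =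
      matrixAction n W fun i j => fderiv ℝ (fun z => m z i j) p v := by
  have h : HasFDerivAt m (ContinuousLinearMap.pi fun i => ContinuousLinearMap.pi fun j =>
      fderiv ℝ (fun z => m z i j) p) p :=
    hasFDerivAt_pi.2 fun i => hasFDerivAt_pi.2 fun j => (hm i j).hasFDerivAt
  have h' : HasFDerivAt (fun z => matrixAction n W (m z)) _ p :=
    (matrixAction n W).hasFDerivAt.comp p h
  rw [h'.fderiv]
  rfl

/-- A flat linear system with matrix coefficients on a rectangle is solvable. -/
theorem exists_smooth_solution_of_flat_matrix [CompleteSpace W] {I J : Set ℝ} (hI : IsOpen I)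
    (hIc : I.OrdConnected) (hJ : IsOpen J) (hJc : J.OrdConnected) {p₀ : ℝ × ℝ}
    (hp₀ : p₀ ∈ I ×ˢ J) {P Q : ℝ × ℝ → Fin n → Fin n → ℝ}
    (hP : ∀ i j, ContDiffOn ℝ ∞ (fun z => P z i j) (I ×ˢ J))
    (hQ : ∀ i j, ContDiffOn ℝ ∞ (fun z => Q z i j) (I ×ˢ J))
    (hflat : ∀ p ∈ I ×ˢ J, ∀ i j, dy (fun z => P z i j) p + ∑ k, P p i k * Q p k j =
      dx (fun z => Q z i j) p + ∑ k, Q p i k * P p k j) (v₀ : Fin n → W) :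
    ∃ u : Fin n → ℝ × ℝ → W, (∀ i, u i p₀ = v₀ i) ∧ (∀ i, ContDiffOn ℝ ∞ (u i) (I ×ˢ J)) ∧
      (∀ i, ∀ p ∈ I ×ˢ J, dx (u i) p = ∑ j, P p i j • u j p) ∧
      ∀ i, ∀ p ∈ I ×ˢ J, dy (u i) p = ∑ j, Q p i j • u j p := by
  have hD : IsOpen (I ×ˢ J) := hI.prod hJ
  obtain ⟨u, hu0, hu, hux, huy⟩ := exists_smooth_solution_of_flat hI hIc hJ hJc hp₀
    (P := fun z => matrixAction n W (P z)) (Q := fun z => matrixAction n W (Q z))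
    ((matrixAction n W).contDiff.comp_contDiffOn
      (contDiffOn_pi.2 fun i => contDiffOn_pi.2 fun j => hP i j))
    ((matrixAction n W).contDiff.comp_contDiffOn
      (contDiffOn_pi.2 fun i => contDiffOn_pi.2 fun j => hQ i j))
    (fun p hp v => by
      rw [dy, dx, fderiv_matrixAction fun i j => (hP i j).differentiableAt_of_isOpen hD hp,
        fderiv_matrixAction fun i j => (hQ i j).differentiableAt_of_isOpen hD hp,
        matrixAction_matrixAction, matrixAction_matrixAction, ← add_apply, ← add_apply, ← map_add,
        ← map_add]
      congr 2
      funext i j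
      exact hflat p hp i j) v₀
  have hfd : ∀ i, ∀ p ∈ I ×ˢ J, ∀ v, fderiv ℝ (fun z => u z i) p v = fderiv ℝ u p v i := by
    intro i p hp v
    rw [fderiv_apply (hu.differentiableAt_of_isOpen hD hp)]
    rfl
  refine ⟨fun i z => u z i, fun i => congr_fun hu0 i, fun i => contDiffOn_pi.1 hu i,
    fun i p hp => ?_, fun i p hp => ?_⟩
  · rw [← matrixAction_apply, ← hux p hp]
    exact hfd i p hp _
  · rw [← matrixAction_apply, ← huy p hp]
    exact hfd i p hp _

end Matrix

/-- Integration of the Gauss and Weingarten equations in coordinates for which both fundamental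
forms are diagonal. -/
theorem exists_frame_of_flat {I J : Set ℝ} (hI : IsOpen I)
    (hIc : I.OrdConnected) (hJ : IsOpen J) (hJc : J.OrdConnected) {p₀ : ℝ × ℝ}
    (hp₀ : p₀ ∈ I ×ˢ J) {A B p q α β κ μ σ τ : ℝ × ℝ → ℝ}
    (hA : ContDiffOn ℝ ∞ A (I ×ˢ J)) (hB : ContDiffOn ℝ ∞ B (I ×ˢ J))
    (hp : ContDiffOn ℝ ∞ p (I ×ˢ J)) (hq : ContDiffOn ℝ ∞ q (I ×ˢ J))
    (hα : ContDiffOn ℝ ∞ α (I ×ˢ J)) (hβ : ContDiffOn ℝ ∞ β (I ×ˢ J))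
    (hκ : ContDiffOn ℝ ∞ κ (I ×ˢ J)) (hμ : ContDiffOn ℝ ∞ μ (I ×ˢ J))
    (hσ : ContDiffOn ℝ ∞ σ (I ×ˢ J)) (hτ : ContDiffOn ℝ ∞ τ (I ×ˢ J))
    (hflat : ∀ z ∈ I ×ˢ J,
      dy α z + κ z * μ z = dx q z + p z * q z ∧
      dy κ z + α z * p z + κ z * β z - σ z * B z = dx p z + q z * κ z + p z ^ 2 ∧
      dy σ z + κ z * τ z = q z * σ z ∧
      dy q z + q z ^ 2 + p z * μ z = dx μ z + μ z * α z + β z * q z - τ z * A z ∧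
      dy p z + q z * p z = dx β z + μ z * κ z ∧
      p z * τ z = dx τ z + μ z * σ z ∧
      dy A z = -q z * (A z - B z) ∧ dx B z = p z * (A z - B z))
    (f₀ g₀ N₀ X₀ : E3) :
    ∃ f g N X : ℝ × ℝ → E3, (f p₀ = f₀ ∧ g p₀ = g₀ ∧ N p₀ = N₀ ∧ X p₀ = X₀) ∧
      (ContDiffOn ℝ ∞ f (I ×ˢ J) ∧ ContDiffOn ℝ ∞ g (I ×ˢ J) ∧ ContDiffOn ℝ ∞ N (I ×ˢ J) ∧
        ContDiffOn ℝ ∞ X (I ×ˢ J)) ∧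
      ∀ z ∈ I ×ˢ J,
        (dx f z = α z • f z + κ z • g z + σ z • N z ∧ dy f z = q z • f z + p z • g z) ∧
        (dx g z = q z • f z + p z • g z ∧ dy g z = μ z • f z + β z • g z + τ z • N z) ∧
        (dx N z = -A z • f z ∧ dy N z = -B z • g z) ∧ dx X z = f z ∧ dy X z = g z := by
  have hD : IsOpen (I ×ˢ J) := hI.prod hJ
  obtain ⟨u, hu0, hu, hux, huy⟩ := exists_smooth_solution_of_flat_matrix hI hIc hJ hJc hp₀
    -- The unknowns are ordered `f`, `g`, `N`, `X`; including `X` integrates the immersion together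
    -- with its frame.
    (P := fun z => ![![α z, κ z, σ z, 0], ![q z, p z, 0, 0], ![-A z, 0, 0, 0], ![1, 0, 0, 0]])
    (Q := fun z => ![![q z, p z, 0, 0], ![μ z, β z, τ z, 0], ![0, -B z, 0, 0], ![0, 1, 0, 0]])
    (fun i j => by
      fin_cases i <;> fin_cases j <;>
        first | exact contDiffOn_const | assumption | exact hA.neg)
    (fun i j => by
      fin_cases i <;> fin_cases j <;>
        first | exact contDiffOn_const | assumption | exact hB.neg)
    (fun z hz i j => by
      obtain ⟨h1, h2, h3, h4, h5, h6, h7, h8⟩ := hflat z hz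
      have hAn : dy (fun z => -A z) z = -dy A z := by rw [dy, fderiv_fun_neg]; rfl
      have hBn : dx (fun z => -B z) z = -dx B z := by rw [dx, fderiv_fun_neg]; rfl
      have cx : ∀ c : ℝ, dx (fun _ => c) z = 0 := fun c => by rw [dx, fderiv_fun_const]; rfl
      have cy : ∀ c : ℝ, dy (fun _ => c) z = 0 := fun c => by rw [dy, fderiv_fun_const]; rfl
      rw [Fin.sum_univ_four, Fin.sum_univ_four]
      -- Eight of the sixteen entries survive `simp` and are the conjuncts of `hflat`. The row of
      -- `X` is automatic because `f_y` and `g_x` have the same expression.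
      fin_cases i <;> fin_cases j <;>
        simp only [Fin.zero_eta, Fin.mk_one, Fin.reduceFinMk, Matrix.cons_val, hAn, hBn, cx, cy,
          mul_zero, zero_mul, add_zero, zero_add, mul_one, one_mul]
      · linear_combination h1
      · linear_combination h2
      · linear_combination h3
      · linear_combination h4
      · linear_combination h5
      · linear_combination h6
      · linear_combination -h7
      · linear_combination h8)
    ![f₀, g₀, N₀, X₀]
  refine ⟨u 0, u 1, u 2, u 3, ⟨hu0 0, hu0 1, hu0 2, hu0 3⟩, ⟨hu 0, hu 1, hu 2, hu 3⟩,
    fun z hz => ?_⟩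
  have hx := fun i => hux i z hz
  have hy := fun i => huy i z hz
  simp only [Fin.sum_univ_four] at hx hy
  refine ⟨⟨?_, ?_⟩, ⟨?_, ?_⟩, ⟨?_, ?_⟩, ?_, ?_⟩
  · simpa using hx 0
  · simpa using hy 0
  · simpa using hx 1
  · simpa using hy 1
  · simpa using hx 2
  · simpa using hy 2
  · simpa using hx 3
  · simpa using hy 3

/-- The completeness relation makes the three vectors span, hence independent by dimension;
comparing coefficients in the expansion of `e j` gives orthonormality. -/
theorem inner_eq_ite_of_sum_inner_smul_eq {e : Fin 3 → E3}
    (h : ∀ w, ∑ i, (inner ℝ (e i) w) • e i = w) (i j : Fin 3) :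
    inner ℝ (e i) (e j) = if i = j then (1 : ℝ) else 0 := by
  have hspan : ⊤ ≤ Submodule.span ℝ (range e) := fun w _ => by
    rw [← h w]
    exact Submodule.sum_mem _ fun i _ =>
      Submodule.smul_mem _ _ (Submodule.subset_span (mem_range_self i))
  have hli := linearIndependent_of_top_le_span_of_card_eq_finrank hspan (by simp)
  have h1 : ∑ k, (inner ℝ (e k) (e j) - if k = j then (1 : ℝ) else 0) • e k = 0 := by
    simp only [sub_smul, Finset.sum_sub_distrib, h, ite_smul, one_smul, zero_smul,
      Finset.sum_ite_eq', Finset.mem_univ, if_true, sub_self]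
  exact sub_eq_zero.1 (Fintype.linearIndependent_iff.1 hli _ h1 i)

end PrescribedShape

/-! ### Construction of a realization from a positive solution. -/

namespace PrescribedShape

open Set Filter Topology

theorem fderiv_mul_inner_mul_inner {a : ℝ × ℝ → ℝ} {f : ℝ × ℝ → E3} {p : ℝ × ℝ}
    (ha : DifferentiableAt ℝ a p) (hf : DifferentiableAt ℝ f p) (w w' : E3) (v : ℝ × ℝ) :
    fderiv ℝ (fun z => a z * (inner ℝ (f z) w * inner ℝ (f z) w')) p v =
      fderiv ℝ a p v * (inner ℝ (f p) w * inner ℝ (f p) w') +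
        a p * (inner ℝ (fderiv ℝ f p v) w * inner ℝ (f p) w' +
          inner ℝ (f p) w * inner ℝ (fderiv ℝ f p v) w') := by
  have hi : ∀ w : E3, DifferentiableAt ℝ (fun z => inner ℝ (f z) w) p := fun w =>
    hf.inner ℝ (differentiableAt_const w)
  have hi' : ∀ w : E3, fderiv ℝ (fun z => inner ℝ (f z) w) p v = inner ℝ (fderiv ℝ f p v) w := by
    intro w
    rw [fderiv_inner_apply ℝ hf (differentiableAt_const w)]
    simp
  rw [fderiv_mul_apply' ha ((hi w).fun_mul (hi w')), fderiv_mul_apply' (hi w) (hi w'), hi', hi']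

/-- The weighted sum of squares of a solution of the structure equations is constant. -/
theorem sum_mul_inner_eq_of_structure_eqs {D : Set (ℝ × ℝ)} (hD : IsOpen D)
    (hDc : IsPreconnected D) {a b : ℝ × ℝ → ℝ} {f g N : ℝ × ℝ → E3}
    (ha : ContDiffOn ℝ ∞ a D) (hb : ContDiffOn ℝ ∞ b D) (hf : ContDiffOn ℝ ∞ f D)
    (hg : ContDiffOn ℝ ∞ g D) (hN : ContDiffOn ℝ ∞ N D) {A B p q α β κ μ σ τ : ℝ × ℝ → ℝ}
    (hstr : ∀ z ∈ D,
      (dx f z = α z • f z + κ z • g z + σ z • N z ∧ dy f z = q z • f z + p z • g z) ∧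
      (dx g z = q z • f z + p z • g z ∧ dy g z = μ z • f z + β z • g z + τ z • N z) ∧
      (dx N z = -A z • f z ∧ dy N z = -B z • g z))
    (hcoef : ∀ z ∈ D, dx a z = -2 * α z * a z ∧ dy a z = -2 * q z * a z ∧
      dx b z = -2 * p z * b z ∧ dy b z = -2 * β z * b z ∧ κ z * a z = -q z * b z ∧
      μ z * b z = -p z * a z ∧ σ z * a z = A z ∧ τ z * b z = B z) (w w' : E3)
    {z z' : ℝ × ℝ} (hz : z ∈ D) (hz' : z' ∈ D) :
    a z * (inner ℝ (f z) w * inner ℝ (f z) w') + b z * (inner ℝ (g z) w * inner ℝ (g z) w')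
        + 1 * (inner ℝ (N z) w * inner ℝ (N z) w') =
      a z' * (inner ℝ (f z') w * inner ℝ (f z') w') + b z' * (inner ℝ (g z') w * inner ℝ (g z') w')
        + 1 * (inner ℝ (N z') w * inner ℝ (N z') w') := by
  have hterm : ∀ {c : ℝ × ℝ → ℝ} {h : ℝ × ℝ → E3} {z : ℝ × ℝ}, DifferentiableAt ℝ c z →
      DifferentiableAt ℝ h z →
      DifferentiableAt ℝ (fun z => c z * (inner ℝ (h z) w * inner ℝ (h z) w')) z :=
    fun hc hh => hc.fun_mul
      ((hh.inner ℝ (differentiableAt_const w)).fun_mul (hh.inner ℝ (differentiableAt_const w')))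
  have da := fun z (hz : z ∈ D) => ha.differentiableAt_of_isOpen hD hz
  have db := fun z (hz : z ∈ D) => hb.differentiableAt_of_isOpen hD hz
  have df := fun z (hz : z ∈ D) => hf.differentiableAt_of_isOpen hD hz
  have dg := fun z (hz : z ∈ D) => hg.differentiableAt_of_isOpen hD hz
  have dN := fun z (hz : z ∈ D) => hN.differentiableAt_of_isOpen hD hz
  refine hD.is_const_of_fderiv_eq_zero hDc (f := fun z =>
    a z * (inner ℝ (f z) w * inner ℝ (f z) w') + b z * (inner ℝ (g z) w * inner ℝ (g z) w')
      + 1 * (inner ℝ (N z) w * inner ℝ (N z) w'))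
    (fun z hz => (((hterm (da z hz) (df z hz)).fun_add (hterm (db z hz) (dg z hz))).fun_add
      (hterm (differentiableAt_const (1 : ℝ)) (dN z hz))).differentiableWithinAt)
    (fun z hz => ?_) hz hz'
  have hexp : ∀ v, fderiv ℝ (fun z => a z * (inner ℝ (f z) w * inner ℝ (f z) w')
      + b z * (inner ℝ (g z) w * inner ℝ (g z) w')
      + 1 * (inner ℝ (N z) w * inner ℝ (N z) w')) z v = _ := fun v => by
    rw [fderiv_add_apply' ((hterm (da z hz) (df z hz)).fun_add (hterm (db z hz) (dg z hz)))
      (hterm (differentiableAt_const (1 : ℝ)) (dN z hz)),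
      fderiv_add_apply' (hterm (da z hz) (df z hz)) (hterm (db z hz) (dg z hz)),
      fderiv_mul_inner_mul_inner (da z hz) (df z hz),
      fderiv_mul_inner_mul_inner (db z hz) (dg z hz),
      fderiv_mul_inner_mul_inner (differentiableAt_const (1 : ℝ)) (dN z hz), fderiv_fun_const]
  obtain ⟨⟨hfx, hfy⟩, ⟨hgx, hgy⟩, hNx, hNy⟩ := hstr z hz
  obtain ⟨c1, c2, c3, c4, c5, c6, c7, c8⟩ := hcoef z hz
  refine ContinuousLinearMap.ext fun v => ?_
  rw [fderiv_apply_eq_dx_dy, dx, dy, hexp, hexp]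
  simp only [dx, dy] at hfx hfy hgx hgy hNx hNy c1 c2 c3 c4
  rw [hfx, hfy, hgx, hgy, hNx, hNy, c1, c2, c3, c4]
  simp only [inner_add_left, inner_smul_left, conj_trivial, Pi.zero_apply, zero_apply,
    smul_eq_mul]
  set f₁ := inner ℝ (f z) w
  set f₂ := inner ℝ (f z) w'
  set g₁ := inner ℝ (g z) w
  set g₂ := inner ℝ (g z) w'
  set n₁ := inner ℝ (N z) w
  set n₂ := inner ℝ (N z) w'
  -- The square terms cancel by the derivatives of `a` and `b`; the cross terms cancel by `c5` to
  -- `c8`. The derivative vanishes identically, so no uniqueness theorem for the Gram matrix is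
  -- needed.
  linear_combination v.1 * ((g₁ * f₂ + f₁ * g₂) * c5 + (n₁ * f₂ + f₁ * n₂) * c7)
    + v.2 * ((f₁ * g₂ + g₁ * f₂) * c6 + (n₁ * g₂ + g₁ * n₂) * c8)

/-- The hypothesis is the completeness relation for `√a f`, `√b g`, `N`. It converts the conserved
form into the Gram matrix; positivity of `a` and `b` enters through the roots. -/
theorem orthogonal_of_sum_mul_inner_eq {a b : ℝ} (ha : 0 < a) (hb : 0 < b) {f g N : E3}
    (h : ∀ w w', a * (inner ℝ f w * inner ℝ f w') + b * (inner ℝ g w * inner ℝ g w')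
      + 1 * (inner ℝ N w * inner ℝ N w') = inner ℝ w w') :
    (inner ℝ f f = 1 / a ∧ inner ℝ g g = 1 / b ∧ inner ℝ N N = (1 : ℝ)) ∧
      inner ℝ f g = (0 : ℝ) ∧ inner ℝ N f = (0 : ℝ) ∧ inner ℝ N g = (0 : ℝ) := by
  have hsa := Real.mul_self_sqrt ha.le
  have hsb := Real.mul_self_sqrt hb.le
  have ha' := Real.sqrt_pos.2 ha
  have hb' := Real.sqrt_pos.2 hb
  have key := inner_eq_ite_of_sum_inner_smul_eq (e := ![√a • f, √b • g, N]) fun w => by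
    refine ext_inner_right ℝ fun w' => ?_
    rw [← h w w', Fin.sum_univ_three]
    simp only [Matrix.cons_val, inner_add_left, inner_smul_left, conj_trivial]
    linear_combination (inner ℝ f w * inner ℝ f w') * hsa + (inner ℝ g w * inner ℝ g w') * hsb
  have k00 := key 0 0
  have k11 := key 1 1
  have k22 := key 2 2
  have k01 := key 0 1
  have k20 := key 2 0
  have k21 := key 2 1
  simp only [Matrix.cons_val, inner_smul_left, inner_smul_right, conj_trivial, if_true, ← mul_assoc,
    hsa, hsb] at k00 k11 k22
  simp only [Matrix.cons_val, inner_smul_left, inner_smul_right, conj_trivial, Fin.reduceEq,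
    if_false, mul_eq_zero, ha'.ne', hb'.ne', false_or] at k01 k20 k21
  exact ⟨⟨by rw [eq_div_iff ha.ne', mul_comm, k00], by rw [eq_div_iff hb.ne', mul_comm, k11], k22⟩,
    k01, k20, k21⟩

theorem sum_single_mul_inner_eq {a b : ℝ} (ha : 0 < a) (hb : 0 < b) (w w' : E3) :
    a * (inner ℝ ((√a)⁻¹ • EuclideanSpace.single 0 1 : E3) w
        * inner ℝ ((√a)⁻¹ • EuclideanSpace.single 0 1 : E3) w')
      + b * (inner ℝ ((√b)⁻¹ • EuclideanSpace.single 1 1 : E3) w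
        * inner ℝ ((√b)⁻¹ • EuclideanSpace.single 1 1 : E3) w')
      + 1 * (inner ℝ (EuclideanSpace.single 2 1 : E3) w
        * inner ℝ (EuclideanSpace.single 2 1 : E3) w') = inner ℝ w w' := by
  have hsa := Real.mul_self_sqrt ha.le
  have hsb := Real.mul_self_sqrt hb.le
  have ha' := (Real.sqrt_pos.2 ha).ne'
  have hb' := (Real.sqrt_pos.2 hb).ne'
  have ka : a * ((√a)⁻¹ * (√a)⁻¹) = 1 := by rw [← mul_inv, hsa, mul_inv_cancel₀ ha.ne']
  have kb : b * ((√b)⁻¹ * (√b)⁻¹) = 1 := by rw [← mul_inv, hsb, mul_inv_cancel₀ hb.ne']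
  simp only [inner_smul_left, EuclideanSpace.inner_single_left, conj_trivial, one_mul]
  rw [PiLp.inner_apply, Fin.sum_univ_three]
  simp only [RCLike.inner_apply, conj_trivial]
  linear_combination (w 0 * w' 0) * ka + (w 1 * w' 1) * kb

theorem SolvesSystem.exists_realization {I J : Set ℝ} (hI : IsOpen I)
    (hIc : I.OrdConnected) (hJ : IsOpen J) (hJc : J.OrdConnected) {p₀ : ℝ × ℝ}
    (hp₀ : p₀ ∈ I ×ˢ J) {A B a b : ℝ × ℝ → ℝ} (hA : ContDiffOn ℝ ∞ A (I ×ˢ J))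
    (hB : ContDiffOn ℝ ∞ B (I ×ˢ J)) (hAB : ∀ p ∈ I ×ˢ J, B p < A p)
    (h : SolvesSystem A B (I ×ˢ J) a b) (ha : ∀ z ∈ I ×ˢ J, 0 < a z)
    (hb : ∀ z ∈ I ×ˢ J, 0 < b z) :
    ∃ r : Realization (I ×ˢ J) (shapeOp A B),
      ∀ z ∈ I ×ˢ J, r.normSqX z = 1 / a z ∧ r.normSqY z = 1 / b z := by
  have hD : IsOpen (I ×ˢ J) := hI.prod hJ
  have hDc : IsPreconnected (I ×ˢ J) := hIc.isPreconnected.prod hJc.isPreconnected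
  have ca := h.smooth_a
  have cb := h.smooth_b
  have sys := (solvesSystem_iff hD hA hB hAB ca cb).1 h
  have cp := contDiffOn_ratioX hD hA hB hAB
  have cq := contDiffOn_ratioY hD hA hB hAB
  have hAy := fun z (hz : z ∈ I ×ˢ J) => dy_eq_ratioY hAB hz
  have hBx := fun z (hz : z ∈ I ×ˢ J) => dx_eq_ratioX hAB hz
  generalize ratioX A B = p at sys cp hBx
  generalize ratioY A B = q at sys cq hAy
  have ha0 := fun z hz => (ha z hz).ne'
  have hb0 := fun z hz => (hb z hz).ne'
  -- These are the remaining Christoffel symbols of the metric `dx²/a + dy²/b` (the mixed ones are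
  -- `q` and `p`), while `σ`, `τ` are the diagonal entries of the second form.
  set α : ℝ × ℝ → ℝ := fun z => -dx a z / (2 * a z) with hα
  set β : ℝ × ℝ → ℝ := fun z => -dy b z / (2 * b z) with hβ
  set κ : ℝ × ℝ → ℝ := fun z => -(q z * b z) / a z with hκ
  set μ : ℝ × ℝ → ℝ := fun z => -(p z * a z) / b z with hμ
  set σ : ℝ × ℝ → ℝ := fun z => A z / a z with hσ
  set τ : ℝ × ℝ → ℝ := fun z => B z / b z with hτ
  have cα : ContDiffOn ℝ ∞ α (I ×ˢ J) := (ca.dx hD).neg.div (contDiffOn_const.mul ca)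
    fun z hz => mul_ne_zero two_ne_zero (ha0 z hz)
  have cβ : ContDiffOn ℝ ∞ β (I ×ˢ J) := (cb.dy hD).neg.div (contDiffOn_const.mul cb)
    fun z hz => mul_ne_zero two_ne_zero (hb0 z hz)
  have cκ : ContDiffOn ℝ ∞ κ (I ×ˢ J) := (cq.mul cb).neg.div ca ha0
  have cμ : ContDiffOn ℝ ∞ μ (I ×ˢ J) := (cp.mul ca).neg.div cb hb0
  have cσ : ContDiffOn ℝ ∞ σ (I ×ˢ J) := hA.div ca ha0
  have cτ : ContDiffOn ℝ ∞ τ (I ×ˢ J) := hB.div cb hb0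
  have hflat : ∀ z ∈ I ×ˢ J,
      dy α z + κ z * μ z = dx q z + p z * q z ∧
      dy κ z + α z * p z + κ z * β z - σ z * B z = dx p z + q z * κ z + p z ^ 2 ∧
      dy σ z + κ z * τ z = q z * σ z ∧
      dy q z + q z ^ 2 + p z * μ z = dx μ z + μ z * α z + β z * q z - τ z * A z ∧
      dy p z + q z * p z = dx β z + μ z * κ z ∧
      p z * τ z = dx τ z + μ z * σ z ∧
      dy A z = -q z * (A z - B z) ∧ dx B z = p z * (A z - B z) := by
    intro z hz
    have dA := hA.differentiableAt_of_isOpen hD hz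
    have dB := hB.differentiableAt_of_isOpen hD hz
    have da := ca.differentiableAt_of_isOpen hD hz
    have db := cb.differentiableAt_of_isOpen hD hz
    have dp := cp.differentiableAt_of_isOpen hD hz
    have dq := cq.differentiableAt_of_isOpen hD hz
    have dax := (ca.dx hD).differentiableAt_of_isOpen hD hz
    have dby := (cb.dy hD).differentiableAt_of_isOpen hD hz
    have za := ha0 z hz
    have zb := hb0 z hz
    obtain ⟨say, sbx, sG⟩ := sys z hz
    have haxy : dy (dx a) z = -2 * dx q z * a z + -2 * q z * dx a z := by
      rw [← dx_dy_comm hD ca hz]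
      have := DFunLike.congr_fun (fderiv_congr_of_eqOn hD (fun z hz => (sys z hz).1) hz)
        ((1, 0) : ℝ × ℝ)
      rw [fderiv_mul_apply' (dq.const_mul _) da, fderiv_const_mul dq] at this
      exact this
    have hbyx : dx (dy b) z = -2 * dy p z * b z + -2 * p z * dy b z := by
      rw [dx_dy_comm hD cb hz]
      have := DFunLike.congr_fun (fderiv_congr_of_eqOn hD (fun z hz => (sys z hz).2.1) hz)
        ((0, 1) : ℝ × ℝ)
      rw [fderiv_mul_apply' (dp.const_mul _) db, fderiv_const_mul dp] at this
      exact this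
    have eα : dy α z = (-dy (dx a) z * (2 * a z) - -dx a z * (2 * dy a z)) / (2 * a z) ^ 2 := by
      have := fderiv_div_apply' (v := ((0, 1) : ℝ × ℝ)) dax.fun_neg (da.const_mul 2)
        (mul_ne_zero two_ne_zero za)
      rw [fderiv_fun_neg, fderiv_const_mul da] at this
      exact this
    have eβ : dx β z = (-dx (dy b) z * (2 * b z) - -dy b z * (2 * dx b z)) / (2 * b z) ^ 2 := by
      have := fderiv_div_apply' (v := ((1, 0) : ℝ × ℝ)) dby.fun_neg (db.const_mul 2)
        (mul_ne_zero two_ne_zero zb)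
      rw [fderiv_fun_neg, fderiv_const_mul db] at this
      exact this
    have eκ : dy κ z = (-(dy q z * b z + q z * dy b z) * a z - -(q z * b z) * dy a z) / a z ^ 2 := by
      have := fderiv_div_apply' (v := ((0, 1) : ℝ × ℝ)) (dq.fun_mul db).fun_neg da za
      rw [fderiv_fun_neg, neg_apply, fderiv_mul_apply' dq db] at this
      exact this
    have eμ : dx μ z = (-(dx p z * a z + p z * dx a z) * b z - -(p z * a z) * dx b z) / b z ^ 2 := by
      have := fderiv_div_apply' (v := ((1, 0) : ℝ × ℝ)) (dp.fun_mul da).fun_neg db zb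
      rw [fderiv_fun_neg, neg_apply, fderiv_mul_apply' dp da] at this
      exact this
    have eσ : dy σ z = (dy A z * a z - A z * dy a z) / a z ^ 2 := fderiv_div_apply' dA da za
    have eτ : dx τ z = (dx B z * b z - B z * dx b z) / b z ^ 2 := fderiv_div_apply' dB db zb
    -- The second and fourth conditions are the Gauss equation `sG`. The first and fifth are
    -- differentiated Codazzi equations, and the third and sixth use those equations with the
    -- formulas for `A_y` and `B_x`.
    refine ⟨?_, ?_, ?_, ?_, ?_, ?_, hAy z hz, hBx z hz⟩
    · rw [eα, haxy, say]
      simp only [hκ, hμ]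
      field_simp
      ring
    · rw [eκ, say]
      simp only [hκ, hβ, hσ, hα]
      field_simp
      linear_combination 2 * sG
    · rw [eσ, say, hAy z hz]
      simp only [hκ, hσ, hτ]
      field_simp
      ring
    · rw [eμ, sbx]
      simp only [hμ, hα, hβ, hτ]
      field_simp
      linear_combination -2 * sG
    · rw [eβ, hbyx, sbx]
      simp only [hκ, hμ]
      field_simp
      ring
    · rw [eτ, sbx, hBx z hz]
      simp only [hμ, hσ, hτ]
      field_simp
      ring
  obtain ⟨f, g, N, X, ⟨hf0, hg0, hN0, -⟩, ⟨cf, cg, cN, cX⟩, heq⟩ :=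
    exists_frame_of_flat hI hIc hJ hJc hp₀ hA hB cp cq cα cβ cκ cμ cσ cτ hflat
      ((√(a p₀))⁻¹ • EuclideanSpace.single 0 1) ((√(b p₀))⁻¹ • EuclideanSpace.single 1 1)
      (EuclideanSpace.single 2 1) 0
  -- The form is constant on the rectangle and equals the inner product at `p₀` by the choice of
  -- initial frame, so the frame is orthogonal with the right lengths everywhere.
  have hort := fun z (hz : z ∈ I ×ˢ J) => orthogonal_of_sum_mul_inner_eq (ha z hz) (hb z hz)
    fun w w' => (sum_mul_inner_eq_of_structure_eqs hD hDc ca cb cf cg cN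
      (fun z hz => ⟨(heq z hz).1, (heq z hz).2.1, (heq z hz).2.2.1⟩)
      (fun z hz => by
        have za := ha0 z hz
        have zb := hb0 z hz
        obtain ⟨say, sbx, -⟩ := sys z hz
        refine ⟨?_, say, sbx, ?_, ?_, ?_, ?_, ?_⟩ <;> simp only [hα, hβ, hκ, hμ, hσ, hτ] <;>
          field_simp)
      w w' hz hp₀).trans (by
        rw [hf0, hg0, hN0]
        exact sum_single_mul_inner_eq (ha p₀ hp₀) (hb p₀ hp₀) w w')
  have hX : ∀ z ∈ I ×ˢ J, ∀ v : ℝ × ℝ, fderiv ℝ X z v = v.1 • f z + v.2 • g z := by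
    intro z hz v
    rw [fderiv_apply_eq_dx_dy, (heq z hz).2.2.2.1, (heq z hz).2.2.2.2]
  have hN : ∀ z ∈ I ×ˢ J, ∀ v : ℝ × ℝ,
      fderiv ℝ N z v = v.1 • (-A z • f z) + v.2 • (-B z • g z) := by
    intro z hz v
    rw [fderiv_apply_eq_dx_dy, (heq z hz).2.2.1.1, (heq z hz).2.2.1.2]
  refine ⟨⟨X, N, cX, cN, fun z hz => ?_, fun z hz => (hort z hz).1.2.2, fun z hz v => ?_,
    fun z hz v w => ?_⟩, fun z hz => ?_⟩
  · obtain ⟨⟨hff, hgg, -⟩, hfg, -⟩ := hort z hz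
    refine (injective_iff_map_eq_zero _).2 fun v hv => ?_
    rw [hX z hz] at hv
    have h1 := congrArg (inner ℝ (f z)) hv
    have h2 := congrArg (inner ℝ (g z)) hv
    rw [real_inner_comm] at hfg
    simp only [inner_add_right, inner_smul_right, hff, hgg, hfg, (real_inner_comm _ _).trans hfg,
      inner_zero_right, mul_zero, add_zero, zero_add, mul_eq_zero,
      (one_div_pos.2 (ha z hz)).ne', (one_div_pos.2 (hb z hz)).ne', or_false] at h1 h2
    exact Prod.ext h1 h2
  · rw [hX z hz, inner_add_right, inner_smul_right, inner_smul_right, (hort z hz).2.2.1,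
      (hort z hz).2.2.2]
    simp
  · obtain ⟨-, hfg, -⟩ := hort z hz
    have hgf := (real_inner_comm _ _).trans hfg
    simp only [secondForm, firstForm, hX z hz, hN z hz, shapeOp, inner_add_left, inner_add_right,
      inner_smul_left, inner_smul_right, hfg, hgf, conj_trivial, ContinuousLinearMap.prod_apply,
      smul_apply, ContinuousLinearMap.coe_fst', ContinuousLinearMap.coe_snd', smul_eq_mul]
    constructor <;> ring
  · obtain ⟨⟨hff, hgg, -⟩, -⟩ := hort z hz
    obtain ⟨-, -, -, hXx, hXy⟩ := heq z hz
    simp only [Realization.normSqX, Realization.normSqY, hXx, hXy]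
    exact ⟨hff, hgg⟩

end PrescribedShape

/-! ### The classification of realizations. -/

open PrescribedShape in
theorem proposition1 (I J : Set ℝ)
    (hI : IsOpen I) (hI_conn : I.OrdConnected) (hI_ne : I.Nonempty)
    (hJ : IsOpen J) (hJ_conn : J.OrdConnected) (hJ_ne : J.Nonempty)
    (A B : ℝ × ℝ → ℝ)
    (hA : ContDiffOn ℝ ∞ A (I ×ˢ J)) (hB : ContDiffOn ℝ ∞ B (I ×ˢ J))
    (hAB : ∀ p ∈ I ×ˢ J, B p < A p) :
    (∃ V : AffineSubspace ℝ ((↥(I ×ˢ J) → ℝ) × (↥(I ×ˢ J) → ℝ)),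
        (V : Set ((↥(I ×ˢ J) → ℝ) × (↥(I ×ˢ J) → ℝ))) = solutionSet A B (I ×ˢ J)) ∧
    ∃ Φ : CongruenceClass (I ×ˢ J) (shapeOp A B) → (↥(I ×ˢ J) → ℝ) × (↥(I ×ˢ J) → ℝ),
      (∀ r : Realization (I ×ˢ J) (shapeOp A B), Φ r.toClass = r.coeffs) ∧
      Function.Injective Φ ∧
      Set.range Φ = {s ∈ solutionSet A B (I ×ˢ J) | ∀ p, 0 < s.1 p ∧ 0 < s.2 p} ∧
      Convex ℝ (Set.range Φ) := by
  have hD : IsOpen (I ×ˢ J) := hI.prod hJ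
  have hDc : IsPreconnected (I ×ˢ J) := hI_conn.isPreconnected.prod hJ_conn.isPreconnected
  obtain ⟨p₀, hp₀⟩ : (I ×ˢ J).Nonempty := hI_ne.prod hJ_ne
  refine ⟨⟨solutionSpace A B hD, rfl⟩, ?_⟩
  let Φ : CongruenceClass (I ×ˢ J) (shapeOp A B) → (↥(I ×ˢ J) → ℝ) × (↥(I ×ˢ J) → ℝ) :=
    Quotient.lift Realization.coeffs fun r s h => Realization.coeffs_eq_of_congruent hD h
  have hrange : Set.range Φ = {s ∈ solutionSet A B (I ×ˢ J) | ∀ p, 0 < s.1 p ∧ 0 < s.2 p} := by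
    ext s
    constructor
    · rintro ⟨c, rfl⟩
      induction c using Quotient.inductionOn with
      | h r =>
        exact ⟨⟨_, _, r.solvesSystem hD hA hB hAB, rfl⟩, fun p =>
          ⟨one_div_pos.2 (r.normSqX_pos p.2), one_div_pos.2 (r.normSqY_pos p.2)⟩⟩
    · rintro ⟨⟨a, b, h, rfl⟩, hpos⟩
      obtain ⟨r, hr⟩ := h.exists_realization hI hI_conn hJ hJ_conn hp₀ hA hB hAB
        (fun z hz => (hpos ⟨z, hz⟩).1) (fun z hz => (hpos ⟨z, hz⟩).2)
      refine ⟨r.toClass, Prod.ext (funext fun z => ?_) (funext fun z => ?_)⟩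
      · change 1 / r.normSqX z = a z
        rw [(hr z z.2).1, one_div_one_div]
      · change 1 / r.normSqY z = b z
        rw [(hr z z.2).2, one_div_one_div]
  refine ⟨Φ, fun r => rfl, ?_, hrange, ?_⟩
  · intro c d
    induction c using Quotient.inductionOn with
    | h r =>
    induction d using Quotient.inductionOn with
    | h s =>
    intro h
    refine Quotient.sound (r.congruent_of_normSq_eq hD hDc hA hB hAB s (fun z hz => ?_)
      fun z hz => ?_)
    · have : 1 / r.normSqX z = 1 / s.normSqX z := congr_fun (congrArg Prod.fst h) ⟨z, hz⟩
      simpa using this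
    · have : 1 / r.normSqY z = 1 / s.normSqY z := congr_fun (congrArg Prod.snd h) ⟨z, hz⟩
      simpa using this
  · rw [hrange]
    -- The image is the intersection of an affine subspace with the convex set of positive pairs.
    refine ((solutionSpace A B hD).convex).inter ?_
    intro s hs t ht c d hc hd hcd p
    constructor
    · exact (convex_Ioi (0 : ℝ)) (hs p).1 (ht p).1 hc hd hcd
    · exact (convex_Ioi (0 : ℝ)) (hs p).2 (ht p).2 hc hd hcd
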